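/- Let $\rho\in(-1,1)$, $\bar\rho=\sqrt{1-\rho^2}$, $\beta\in[0,1]$, $S=\mathbb R\times(0,\infty)$ and $\mathcal S=(0,\infty)^2$; for $x<0$ read $x^{\gamma}$ as $|x|^{\gamma}$. For $j\in\{0,1\}$ let $m_j(x,y)=\frac{1}{\bar\rho\,|x|^{\beta(1+j)}y^2}$, $\mathcal H_j=L^2(S,m_j\,dx\,dy)$ and $$\mathcal E_{m_j}(f_1,f_2)=\frac12\int_S\Gamma(f_1,f_2)\,m_j\,dx\,dy,\qquad \Gamma(f_1,f_2)=y^2\bigl(|x|^{2\beta}\partial_xf_1\partial_xf_2+\rho|x|^{\beta}(\partial_xf_1\partial_yf_2+\partial_yf_1\partial_xf_2)+\partial_yf_1\partial_yf_2\bigr).$$ Let $D(\mathcal E_{m_j})$ be the set of all $u\in\mathcal H_j$ such that for almost every $\bar y>0$ the function $x\mapsto u(x,\bar y)$ has a version that is absolutely continuous on the compact intervals of $\mathbb R$, for almost every $\bar x\in\mathbb R$ the function $y\mapsto u(\bar x,y)$ has a version that is absolutely continuous on the compact intervals of $(0,\infty)$, and $\Gamma(u,u)\in L^1(S,m_j\,dx\,dy)$,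 the partial derivatives being those of these versions. A symmetric form on a real Hilbert space $\mathcal H$ is a nonnegative symmetric bilinear form $\mathcal E$ on a dense subspace $D$; it is closed if $D$ is complete for the norm $(\mathcal E(u,u)+\|u\|^2)^{1/2}$, and closable if it has a closed extension. A Dirichlet form on an $L^2$ space is a closed form such that $u\in D$ implies $u^+\wedge1\in D$ and $\mathcal E(u^+\wedge1,u^+\wedge1)\le\mathcal E(u,u)$. The generator $\Phi(\mathcal E)$ of a form is given by: $u\in D(\Phi(\mathcal E))$ and $\Phi(\mathcal E)u=w$ if and only if $u\in D$, $w\in\mathcal H$ and $\mathcal E(u,v)=-(w,v)_{\mathcal H}$ for all $v\in D$. Put $$Af=\tfrac12y^2\bigl(x^{2\beta}\partial_{xx}f+2\rho x^{\beta}\partial_{xy}f+\partial_{yy}f\bigr),\qquad \Delta_gf=\tfrac{\beta}{2}y^2x^{2\beta-1}\partial_xf+Af .$$ **Theorem.** The spaces $\mathcal H_0,\mathcal H_1$ are Hilbert spaces, and the following holds. (i) If $j=0$ and $\beta\in[0,1)$, or $j=1$ and $\beta\in[0,1/2)$, then $C_0^\infty(S)\subset\mathcal H_j$, and $(\mathcal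 E_{m_j},C_0^\infty(S))$ is a symmetric form on $\mathcal H_j$ and is closable. (ii) In the same cases $(\mathcal E_{m_j},D(\mathcal E_{m_j}))$ is a Dirichlet form on $\mathcal H_j$, and it extends $(\mathcal E_{m_j},C_0^\infty(S))$. (iii) On $\mathcal S$, $\Delta_g$ is one half of the Laplace–Beltrami operator of the metric $g=\frac1{1-\rho^2}\Bigl(\frac{dx^2}{y^2x^{2\beta}}-\frac{2\rho\,dx\,dy}{y^2x^\beta}+\frac{dy^2}{y^2}\Bigr)$. For all $f_1,f_2\in C_0^\infty(\mathcal S)$ one has $(\Delta_gf_1,f_2)_{\mathcal H_0}=-\mathcal E_{m_0}(f_1,f_2)$; and if $\beta<1$, then $f_1\in D(\Phi(\mathcal E_{m_0}))$, $\Phi(\mathcal E_{m_0})f_1=\Delta_gf_1$ and $$(\Phi(\mathcal E_{m_0})f_1,f_2)_{\mathcal H_0}=(\Delta_gf_1,f_2)_{\mathcal H_0}=-\mathcal E_{m_0}(f_1,f_2).$$ If $\beta=0$, the same holds with $A$ in place of $\Delta_g$. (iv) If $\rho=0$, then $(Af_1,f_2)_{\mathcal H_1}=-\mathcal E_{m_1}(f_1,f_2)$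 for all $f_1,f_2\in C_0^\infty(\mathcal S)$; and if moreover $\beta<1/2$, then $f_1\in D(\Phi(\mathcal E_{m_1}))$, $\Phi(\mathcal E_{m_1})f_1=Af_1$ and $$(\Phi(\mathcal E_{m_1})f_1,f_2)_{\mathcal H_1}=(Af_1,f_2)_{\mathcal H_1}=-\mathcal E_{m_1}(f_1,f_2).$$ -/

import Mathlib

open MeasureTheory Set Filter Topology
open scoped ENNReal ContDiff

noncomputable section

namespace SABR

/-! ### Symmetric, closed, closable forms and their generators on a real Hilbert space -/

section Forms

variable {H : Type*} [NormedAddCommGroup H] [InnerProductSpace ℝ H]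

/-- `(E, D)` is a symmetric form on `H`: `D` is a dense linear subspace and `E` is bilinear,
symmetric and nonnegative on `D`. The values of `E` outside `D` play no role. -/
structure IsSymmetricForm (D : Set H) (E : H → H → ℝ) : Prop where
  zero_mem : (0 : H) ∈ D
  add_mem : ∀ u ∈ D, ∀ v ∈ D, u + v ∈ D
  smul_mem : ∀ (c : ℝ), ∀ u ∈ D, c • u ∈ D
  dense : Dense D
  add_left : ∀ u₁ ∈ D, ∀ u₂ ∈ D, ∀ v ∈ D, E (u₁ + u₂) v = E u₁ v + E u₂ v
  smul_left : ∀ (c : ℝ), ∀ u ∈ D, ∀ v ∈ D, E (c • u) v = c * E u v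
  symm : ∀ u ∈ D, ∀ v ∈ D, E u v = E v u
  nonneg : ∀ u ∈ D, 0 ≤ E u u

/-- The square of the norm `‖u‖_{E₁} = (E(u,u) + ‖u‖²)^{1/2}`. -/
def normE1Sq (E : H → H → ℝ) (u : H) : ℝ := E u u + ‖u‖ ^ 2

/-- A closed form: a symmetric form whose domain is complete for the norm `‖·‖_{E₁}`. -/
structure IsClosedForm (D : Set H) (E : H → H → ℝ) : Prop extends IsSymmetricForm D E where
  complete : ∀ u : ℕ → H, (∀ n, u n ∈ D) →
    (∀ ε > 0, ∃ N, ∀ m ≥ N, ∀ n ≥ N, normE1Sq E (u m - u n) < ε) →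
    ∃ v ∈ D, Tendsto (fun n => normE1Sq E (u n - v)) atTop (𝓝 0)

/-- A form is closable if it has a closed extension. -/
def IsClosable (D : Set H) (E : H → H → ℝ) : Prop :=
  ∃ (D' : Set H) (E' : H → H → ℝ), IsClosedForm D' E' ∧ D ⊆ D' ∧
    ∀ u ∈ D, ∀ v ∈ D, E' u v = E u v

/-- The domain of the generator of the form `(E, D)`: those `u ∈ D` for which there is `w ∈ H`
with `E(u,v) = -(w,v)` for all `v ∈ D`. -/
def generatorDomain (D : Set H) (E : H → H → ℝ) : Set H :=
  {u | u ∈ D ∧ ∃ w : H, ∀ v ∈ D, E u v = -inner ℝ w v}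

/-- The generator of the form `(E, D)`: for `u` in its domain, the element `w` of `H` with
`E(u,v) = -(w,v)` for all `v ∈ D` (unique, since `D` is dense). -/
def generator (D : Set H) (E : H → H → ℝ) (u : H) : H :=
  Classical.epsilon fun w : H => ∀ v ∈ D, E u v = -inner ℝ w v

end Forms

/-- A Dirichlet form on `L²(μ)`: a closed form that is Markovian, i.e. for every `u ∈ D` also
`u⁺ ∧ 1 ∈ D` and `E(u⁺ ∧ 1, u⁺ ∧ 1) ≤ E(u,u)`. -/
structure IsDirichletForm {α : Type*} [MeasurableSpace α] {μ : Measure α}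
    (D : Set (Lp ℝ 2 μ)) (E : Lp ℝ 2 μ → Lp ℝ 2 μ → ℝ) : Prop extends IsClosedForm D E where
  markov : ∀ u ∈ D, ∃ w ∈ D, (w =ᵐ[μ] fun p => min (max (u p) 0) 1) ∧ E w w ≤ E u u

/-! ### Absolutely continuous versions -/

/-- `w` is (locally) absolutely continuous on `I`: absolutely continuous on every compact
interval contained in `I`. -/
def LocallyAC (I : Set ℝ) (w : ℝ → ℝ) : Prop :=
  ∀ a b : ℝ, uIcc a b ⊆ I → AbsolutelyContinuousOnInterval w a b

/-- `w` is an absolutely continuous version of `h` on `I`. -/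
def IsACVersion (I : Set ℝ) (h w : ℝ → ℝ) : Prop :=
  LocallyAC I w ∧ h =ᵐ[volume.restrict I] w

/-- The absolutely continuous version of `h` on `I` (an arbitrary function if there is none).
On an open interval `I` it is unique as a function on `I`, since it is continuous there. -/
def acVersion (I : Set ℝ) (h : ℝ → ℝ) : ℝ → ℝ :=
  Classical.epsilon (IsACVersion I h)

/-! ### The weighted spaces and the energy form -/

/-- The half-plane `S = ℝ × (0,∞)`. -/
def halfPlane : Set (ℝ × ℝ) := {p | 0 < p.2}

/-- The open quadrant `𝒮 = (0,∞)²`. -/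
def quadrant : Set (ℝ × ℝ) := {p | 0 < p.1 ∧ 0 < p.2}

/-- `f ∈ C_0^∞(U)`, for `U` open: smooth with compact support in `U` (extended by zero). -/
def IsTest (U : Set (ℝ × ℝ)) (f : ℝ × ℝ → ℝ) : Prop :=
  ContDiff ℝ ∞ f ∧ HasCompactSupport f ∧ tsupport f ⊆ U

/-- The measure `m_j(x,y) dx dy` on `S`, with `m_j = 1 / (ρ̄ |x|^{β(1+j)} y²)`,
`ρ̄ = √(1-ρ²)`. -/
def speedMeasure (ρ β : ℝ) (j : ℕ) : Measure (ℝ × ℝ) :=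
  (volume.restrict halfPlane).withDensity fun p =>
    ENNReal.ofReal (1 / (√(1 - ρ ^ 2) * |p.1| ^ (β * (1 + j)) * p.2 ^ 2))

/-- The weighted space `H_j = L²(S, m_j(x,y) dx dy)`. -/
abbrev HilbertL2 (ρ β : ℝ) (j : ℕ) := Lp ℝ 2 (speedMeasure ρ β j)

/-- The symmetric bilinear expression
`y² (x^{2β} a₁ b₁ + ρ x^β (a₁ b₂ + a₂ b₁) + a₂ b₂)` in two gradients `a`, `b` at `p = (x,y)`,
with `x^β` read as `|x|^β`. -/
def gammaGrad (ρ β : ℝ) (p a b : ℝ × ℝ) : ℝ :=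
  p.2 ^ 2 * (|p.1| ^ (2 * β) * a.1 * b.1 + ρ * |p.1| ^ β * (a.1 * b.2 + a.2 * b.1) + a.2 * b.2)

/-- Classical partial derivative in `x`. -/
def partialX (f : ℝ × ℝ → ℝ) (p : ℝ × ℝ) : ℝ := deriv (fun s => f (s, p.2)) p.1

/-- Classical partial derivative in `y`. -/
def partialY (f : ℝ × ℝ → ℝ) (p : ℝ × ℝ) : ℝ := deriv (fun t => f (p.1, t)) p.2

/-- `Γ(f₁,f₂)` for smooth functions. -/
def gammaSmooth (ρ β : ℝ) (f₁ f₂ : ℝ × ℝ → ℝ) (p : ℝ × ℝ) : ℝ :=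
  gammaGrad ρ β p (partialX f₁ p, partialY f₁ p) (partialX f₂ p, partialY f₂ p)

/-- The gradient of `u` on `S`, formed with the derivatives of the absolutely continuous
versions of `x ↦ u(x,ȳ)` on `ℝ` and of `y ↦ u(x̄,y)` on `(0,∞)`. -/
def acGradient (u : ℝ × ℝ → ℝ) (p : ℝ × ℝ) : ℝ × ℝ :=
  (deriv (acVersion univ fun s => u (s, p.2)) p.1,
   deriv (acVersion (Ioi 0) fun t => u (p.1, t)) p.2)

/-- `Γ(u,v)` for functions with absolutely continuous versions on lines. -/
def gammaAC (ρ β : ℝ) (u v : ℝ × ℝ → ℝ) (p : ℝ × ℝ) : ℝ :=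
  gammaGrad ρ β p (acGradient u p) (acGradient v p)

/-- The energy form `E_{m_j}(u,v) = ½ ∫_S Γ(u,v) m_j dx dy`. -/
def energy (ρ β : ℝ) (j : ℕ) (u v : HilbertL2 ρ β j) : ℝ :=
  (1 / 2) * ∫ p, gammaAC ρ β u v p ∂(speedMeasure ρ β j)

/-- The domain `D(E_{m_j})`: the `u ∈ H_j` that have absolutely continuous versions on almost
all lines parallel to the axes and satisfy `Γ(u,u) ∈ L¹(S, m_j dx dy)`. -/
def energyDomain (ρ β : ℝ) (j : ℕ) : Set (HilbertL2 ρ β j) :=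
  {u | (∀ᵐ y ∂(volume.restrict (Ioi (0 : ℝ))), ∃ w, IsACVersion univ (fun s => u (s, y)) w) ∧
    (∀ᵐ x ∂(volume : Measure ℝ), ∃ w, IsACVersion (Ioi 0) (fun t => u (x, t)) w) ∧
    Integrable (gammaAC ρ β u u) (speedMeasure ρ β j)}

/-- `C_0^∞(S)` as a set of elements of `H_j`. -/
def testDomain (ρ β : ℝ) (j : ℕ) : Set (HilbertL2 ρ β j) :=
  {u | ∃ f, IsTest halfPlane f ∧ u =ᵐ[speedMeasure ρ β j] f}

/-! ### The differential operators -/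

/-- The SABR generator `A f = ½ y² (x^{2β} f_xx + 2ρ x^β f_xy + f_yy)`. -/
def sabrGenerator (ρ β : ℝ) (f : ℝ × ℝ → ℝ) (p : ℝ × ℝ) : ℝ :=
  (1 / 2) * p.2 ^ 2 * (p.1 ^ (2 * β) * partialX (partialX f) p
    + 2 * ρ * p.1 ^ β * partialX (partialY f) p + partialY (partialY f) p)

/-- The operator `Δ_g f = (β/2) y² x^{2β-1} f_x + A f`. -/
def sabrLaplace (ρ β : ℝ) (f : ℝ × ℝ → ℝ) (p : ℝ × ℝ) : ℝ :=
  β / 2 * p.2 ^ 2 * p.1 ^ (2 * β - 1) * partialX f p + sabrGenerator ρ β f p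

/-- The SABR metric
`g = (1-ρ²)⁻¹ (dx²/(y² x^{2β}) - 2ρ dx dy/(y² x^β) + dy²/y²)` on `(0,∞)²`. -/
def sabrMetric (ρ β : ℝ) (p : ℝ × ℝ) : Matrix (Fin 2) (Fin 2) ℝ :=
  (1 / (1 - ρ ^ 2)) •
    !![1 / (p.2 ^ 2 * p.1 ^ (2 * β)), -ρ / (p.2 ^ 2 * p.1 ^ β);
       -ρ / (p.2 ^ 2 * p.1 ^ β), 1 / p.2 ^ 2]

/-- The Laplace–Beltrami operator of a metric `g` in the coordinates `(x,y)`: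
`(det g)^{-1/2} ∑ᵢ ∂ᵢ ((det g)^{1/2} ∑ₖ g^{ik} ∂ₖ f)`. -/
def laplaceBeltrami (g : ℝ × ℝ → Matrix (Fin 2) (Fin 2) ℝ) (f : ℝ × ℝ → ℝ) (p : ℝ × ℝ) : ℝ :=
  (√(g p).det)⁻¹ *
    (partialX (fun q => √(g q).det * ((g q)⁻¹ 0 0 * partialX f q + (g q)⁻¹ 0 1 * partialY f q)) p
    + partialY (fun q => √(g q).det *
        ((g q)⁻¹ 1 0 * partialX f q + (g q)⁻¹ 1 1 * partialY f q)) p)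

/-- The generator of `(E_{m_j}, D(E_{m_j}))` is defined on `C_0^∞((0,∞)²)`, agrees there with
the operator `L`, and `(Φ f₁, f₂) = (L f₁, f₂) = -E_{m_j}(f₁, f₂)`, the scalar products being
those of `H_j`. -/
def GeneratorAgrees (ρ β : ℝ) (j : ℕ) (L : (ℝ × ℝ → ℝ) → ℝ × ℝ → ℝ) : Prop :=
  ∀ f₁, IsTest quadrant f₁ → ∀ u₁ : HilbertL2 ρ β j, u₁ =ᵐ[speedMeasure ρ β j] f₁ →
    u₁ ∈ generatorDomain (energyDomain ρ β j) (energy ρ β j) ∧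
    (generator (energyDomain ρ β j) (energy ρ β j) u₁ : HilbertL2 ρ β j)
      =ᵐ[speedMeasure ρ β j] L f₁ ∧
    ∀ f₂, IsTest quadrant f₂ → ∀ u₂ : HilbertL2 ρ β j, u₂ =ᵐ[speedMeasure ρ β j] f₂ →
      inner ℝ (generator (energyDomain ρ β j) (energy ρ β j) u₁) u₂
        = ∫ p, L f₁ p * f₂ p ∂(speedMeasure ρ β j) ∧
      ∫ p, L f₁ p * f₂ p ∂(speedMeasure ρ β j) = -energy ρ β j u₁ u₂

/-- Integration by parts: `(L f₁, f₂) = -½ ∫_S Γ(f₁,f₂) m_j dx dy` for `f₁, f₂` in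
`C_0^∞((0,∞)²)`. -/
def FormIdentity (ρ β : ℝ) (j : ℕ) (L : (ℝ × ℝ → ℝ) → ℝ × ℝ → ℝ) : Prop :=
  ∀ f₁ f₂, IsTest quadrant f₁ → IsTest quadrant f₂ →
    ∫ p, L f₁ p * f₂ p ∂(speedMeasure ρ β j)
      = -((1 / 2) * ∫ p, gammaSmooth ρ β f₁ f₂ p ∂(speedMeasure ρ β j))

end SABR

end

/-!
For every `β` and `j` one has `E_{m_j}(u,v) = B(Tu, Tv)`, where `Tu = (y |x|^β ∂ₓu, y ∂_y u)` and
`B` is the bilinear form of the matrix `½ (1 ρ; ρ 1)` on `H_j × H_j`, which is equivalent to the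
inner product because `|ρ| < 1`. Such a form is closed as soon as the graph of `T` is closed in
`H_j × (H_j × H_j)`. If `(uₙ, Tuₙ)` converges, then by Fubini a subsequence converges on almost
every line parallel to an axis, in `L²` with a weight whose inverse is locally integrable on the
line. This controls the derivatives in `L¹` on compact intervals, so the limit is the integral of
its derivative; on the lines `y = const` local integrability of the inverse weight is a condition
on the exponent at `x = 0`.

The Markov property is the chain rule for `u⁺ ∧ 1`, whose gradient is `1_{0 < u < 1} ∇u`. Local
integrability of `m_j` and of `y² |x|^{2β} m_j` puts the test functions into the domain.

With `a` the coefficient matrix of `Γ`, the generators come from Green's formula for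
`(2 m_j)⁻¹ div (m_j a ∇f)`: for a test function `f` of the quadrant the flux `m_j a ∇f` is smooth
with compact support, and integration by parts against an arbitrary `v` of the domain is
one-dimensional on almost every line. Expanding the divergence gives `Δ_g` for `j = 0`, and `A` for
`j = 1`, `ρ = 0`; since `m_0` is the Riemannian density of `g` and `a` its inverse metric, `Δ_g` is
also one half of the Laplace–Beltrami operator.
-/

noncomputable section

namespace SABR

section AbsolutelyContinuousVersions

/-! ### Absolutely continuous versions on an open set of reals -/

/-- `h` has an absolutely continuous version on `I` whose derivative is a.e. equal to `k`.
Both `h` and `k` matter only up to null sets of `I`. -/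
def HasACDeriv (I : Set ℝ) (h k : ℝ → ℝ) : Prop :=
  ∃ w, IsACVersion I h w ∧ ∀ᵐ t ∂volume.restrict I, HasDerivAt w (k t) t

variable {I : Set ℝ} {h h' k k' w w' : ℝ → ℝ} {a b : ℝ}

lemma exists_uIcc_mem_nhds (hI : IsOpen I) {t : ℝ} (ht : t ∈ I) :
    ∃ a b, uIcc a b ∈ 𝓝 t ∧ uIcc a b ⊆ I := by
  obtain ⟨ε, hε, hsub⟩ := Metric.nhds_basis_closedBall.mem_iff.1 (hI.mem_nhds ht)
  have hball : uIcc (t - ε) (t + ε) = Metric.closedBall t ε := by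
    rw [Real.closedBall_eq_Icc, uIcc_of_le (by linarith)]
  exact ⟨t - ε, t + ε, hball ▸ Metric.closedBall_mem_nhds t hε, hball ▸ hsub⟩

lemma ae_restrict_of_forall_uIcc (hI : IsOpen I) {p : ℝ → Prop}
    (h : ∀ a b, uIcc a b ⊆ I → ∀ᵐ t, t ∈ uIcc a b → p t) : ∀ᵐ t ∂volume.restrict I, p t := by
  rw [ae_restrict_iff' hI.measurableSet, ae_iff]
  refine measure_null_of_locally_null _ fun t ht => ?_
  obtain ⟨a, b, hnhds, hsub⟩ := exists_uIcc_mem_nhds hI (Classical.not_imp.1 ht).1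
  refine ⟨_, inter_mem_nhdsWithin _ hnhds, measure_mono_null ?_ (ae_iff.1 (h a b hsub))⟩
  exact fun s hs hp => (Classical.not_imp.1 hs.1).2 (hp hs.2)

lemma ae_restrict_uIoc_of_ae_restrict {p : ℝ → Prop} (h : ∀ᵐ t ∂volume.restrict I, p t)
    (hab : uIcc a b ⊆ I) : ∀ᵐ t ∂volume.restrict (uIoc a b), p t :=
  ae_restrict_of_ae_restrict_of_subset (uIoc_subset_uIcc.trans hab) h

lemma LocallyAC.continuousOn (hI : IsOpen I) (hw : LocallyAC I w) : ContinuousOn w I := by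
  intro t ht
  obtain ⟨a, b, hnhds, hsub⟩ := exists_uIcc_mem_nhds hI ht
  exact ((hw a b hsub).continuousOn.continuousAt hnhds).continuousWithinAt

lemma LocallyAC.ae_differentiableAt (hI : IsOpen I) (hw : LocallyAC I w) :
    ∀ᵐ t ∂volume.restrict I, DifferentiableAt ℝ w t :=
  ae_restrict_of_forall_uIcc hI fun a b hab => (hw a b hab).ae_differentiableAt

lemma LocallyAC.intervalIntegrable (hw : LocallyAC I w)
    (hk : ∀ᵐ t ∂volume.restrict I, HasDerivAt w (k t) t) (hab : uIcc a b ⊆ I) :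
    IntervalIntegrable k volume a b :=
  (hw a b hab).intervalIntegrable_deriv.congr_ae <|
    (ae_restrict_uIoc_of_ae_restrict hk hab).mono fun _ ht => ht.deriv

lemma LocallyAC.integral_eq_sub (hw : LocallyAC I w)
    (hk : ∀ᵐ t ∂volume.restrict I, HasDerivAt w (k t) t) (hab : uIcc a b ⊆ I) :
    ∫ t in a..b, k t = w b - w a := by
  rw [← (hw a b hab).integral_deriv_eq_sub]
  exact intervalIntegral.integral_congr_ae_restrict <|
    (ae_restrict_uIoc_of_ae_restrict hk hab).mono fun _ ht => ht.deriv.symm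

lemma LocallyAC.lipschitzWith_comp {φ : ℝ → ℝ} (hφ : LipschitzWith 1 φ) (hw : LocallyAC I w) :
    LocallyAC I fun t => φ (w t) := by
  intro a b hab
  have hwab := hw a b hab
  rw [absolutelyContinuousOnInterval_iff] at hwab ⊢
  refine fun ε hε => (hwab ε hε).imp fun δ ⟨hδ, h⟩ => ⟨hδ, fun E hE hEδ => ?_⟩
  refine (Finset.sum_le_sum fun i _ => ?_).trans_lt (h E hE hEδ)
  simpa using hφ.dist_le_mul (w (E.2 i).1) (w (E.2 i).2)

lemma IsACVersion.eqOn (hI : IsOpen I) (hw : IsACVersion I h w) (hw' : IsACVersion I h w') :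
    EqOn w w' I :=
  Measure.eqOn_open_of_ae_eq (hw.2.symm.trans hw'.2) hI (hw.1.continuousOn hI)
    (hw'.1.continuousOn hI)

lemma IsACVersion.hasACDeriv (hI : IsOpen I) (hw : IsACVersion I h w) :
    HasACDeriv I h (deriv w) :=
  ⟨w, hw, (hw.1.ae_differentiableAt hI).mono fun _ ht => ht.hasDerivAt⟩

lemma hasACDeriv_of_contDiff (hI : IsOpen I) {f : ℝ → ℝ} (hf : ContDiff ℝ 1 f) :
    HasACDeriv I f (deriv f) :=
  IsACVersion.hasACDeriv hI
    ⟨fun _ _ _ => hf.contDiffOn.absolutelyContinuousOnInterval, EventuallyEq.rfl⟩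

lemma HasACDeriv.isACVersion_acVersion (H : HasACDeriv I h k) :
    IsACVersion I h (acVersion I h) :=
  Classical.epsilon_spec (H.imp fun _ hw => hw.1)

lemma HasACDeriv.ae_hasDerivAt (hI : IsOpen I) (H : HasACDeriv I h k) (hw : IsACVersion I h w) :
    ∀ᵐ t ∂volume.restrict I, HasDerivAt w (k t) t := by
  obtain ⟨w', hw', hk⟩ := H
  filter_upwards [hk, ae_restrict_mem hI.measurableSet] with t hkt ht
  exact hkt.congr_of_eventuallyEq ((hw.eqOn hI hw').eventuallyEq_of_mem (hI.mem_nhds ht))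

lemma HasACDeriv.congr (H : HasACDeriv I h k) (hh : h =ᵐ[volume.restrict I] h')
    (hk : k =ᵐ[volume.restrict I] k') : HasACDeriv I h' k' := by
  obtain ⟨w, hw, hwk⟩ := H
  exact ⟨w, ⟨hw.1, hh.symm.trans hw.2⟩, by filter_upwards [hwk, hk] with t h1 h2 using h2 ▸ h1⟩

lemma HasACDeriv.add (H : HasACDeriv I h k) (H' : HasACDeriv I h' k') :
    HasACDeriv I (fun t => h t + h' t) fun t => k t + k' t := by
  obtain ⟨w, hw, hk⟩ := H
  obtain ⟨w', hw', hk'⟩ := H'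
  refine ⟨fun t => w t + w' t, ⟨fun a b hab => (hw.1 a b hab).add (hw'.1 a b hab),
    hw.2.add hw'.2⟩, ?_⟩
  filter_upwards [hk, hk'] with t h1 h2 using h1.add h2

lemma HasACDeriv.const_mul (c : ℝ) (H : HasACDeriv I h k) :
    HasACDeriv I (fun t => c * h t) fun t => c * k t := by
  obtain ⟨w, hw, hk⟩ := H
  refine ⟨fun t => c * w t, ⟨fun a b hab => (hw.1 a b hab).const_mul c,
    hw.2.fun_comp (c * ·)⟩, ?_⟩
  filter_upwards [hk] with t h1 using h1.const_mul c

/-- The unit contraction `t ↦ t⁺ ∧ 1`. -/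
def unitClamp (t : ℝ) : ℝ := min (max t 0) 1

lemma lipschitzWith_unitClamp : LipschitzWith 1 unitClamp :=
  (LipschitzWith.id.max_const 0).min_const 1

lemma unitClamp_nonneg (t : ℝ) : 0 ≤ unitClamp t := le_min (le_max_right _ _) zero_le_one

lemma unitClamp_le_one (t : ℝ) : unitClamp t ≤ 1 := min_le_right _ _

lemma unitClamp_of_nonpos {t : ℝ} (ht : t ≤ 0) : unitClamp t = 0 := by simp [unitClamp, ht]

lemma unitClamp_of_one_le {t : ℝ} (ht : 1 ≤ t) : unitClamp t = 1 := by simp [unitClamp, ht]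

lemma unitClamp_of_mem_Ioo {t : ℝ} (ht : t ∈ Ioo (0 : ℝ) 1) : unitClamp t = t := by
  rw [unitClamp, max_eq_left ht.1.le, min_eq_left ht.2.le]

lemma deriv_unitClamp_comp {t : ℝ} (hw : ContinuousAt w t) :
    deriv (fun s => unitClamp (w s)) t = (Ioo (0 : ℝ) 1).indicator 1 (w t) * deriv w t := by
  by_cases hmem : w t ∈ Ioo (0 : ℝ) 1
  · rw [indicator_of_mem hmem, Pi.one_apply, one_mul]
    refine EventuallyEq.deriv_eq ?_
    filter_upwards [hw (isOpen_Ioo.mem_nhds hmem)] with s hs using unitClamp_of_mem_Ioo hs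
  · rw [indicator_of_notMem hmem, zero_mul]
    -- Outside `(0,1)` the clamped function has a local extremum.
    rcases le_or_gt (w t) 0 with h0 | h0
    · refine IsLocalMin.deriv_eq_zero (Eventually.of_forall fun s => ?_)
      exact (unitClamp_of_nonpos h0).trans_le (unitClamp_nonneg (w s))
    · refine IsLocalMax.deriv_eq_zero (Eventually.of_forall fun s => ?_)
      have h1 : 1 ≤ w t := not_lt.1 fun h1 => hmem ⟨h0, h1⟩
      exact (unitClamp_le_one (w s)).trans_eq (unitClamp_of_one_le h1).symm

lemma HasACDeriv.unitClamp_comp (hI : IsOpen I) (H : HasACDeriv I h k) :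
    HasACDeriv I (fun t => unitClamp (h t)) fun t => (Ioo (0 : ℝ) 1).indicator 1 (h t) * k t := by
  obtain ⟨w, hw, hk⟩ := H
  have hclamp : IsACVersion I (fun t => unitClamp (h t)) fun t => unitClamp (w t) :=
    ⟨hw.1.lipschitzWith_comp lipschitzWith_unitClamp, hw.2.fun_comp unitClamp⟩
  refine (hclamp.hasACDeriv hI).congr EventuallyEq.rfl ?_
  filter_upwards [hk, hw.2] with t h1 h2
  rw [deriv_unitClamp_comp h1.continuousAt, h1.deriv, h2]

lemma tendsto_add_inv_natCast (t : ℝ) :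
    Tendsto (fun n : ℕ => t + ((n : ℝ) + 1)⁻¹) atTop (𝓝 t) := by
  simpa using tendsto_const_nhds.add (tendsto_one_div_add_atTop_nhds_zero_nat (𝕜 := ℝ))

lemma HasACDeriv.ae_tendsto_slope (hI : IsOpen I) (H : HasACDeriv I h k) :
    ∀ᵐ t ∂volume.restrict I, Tendsto
      (fun n : ℕ => ((n : ℝ) + 1) * (h (t + ((n : ℝ) + 1)⁻¹) - h t)) atTop (𝓝 (k t)) := by
  obtain ⟨w, hw, hk⟩ := H
  have hshift : ∀ᵐ t, ∀ n : ℕ, t + ((n : ℝ) + 1)⁻¹ ∈ I →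
      h (t + ((n : ℝ) + 1)⁻¹) = w (t + ((n : ℝ) + 1)⁻¹) :=
    ae_all_iff.2 fun n => (measurePreserving_add_right volume ((n : ℝ) + 1)⁻¹
      ).quasiMeasurePreserving.ae ((ae_restrict_iff' hI.measurableSet).1 hw.2)
  filter_upwards [ae_restrict_of_ae hshift, hw.2, hk, ae_restrict_mem hI.measurableSet]
    with t h1 h2 h3 ht
  have hslope := (hasDerivAt_iff_tendsto_slope_zero.1 h3).comp
    (f := fun n : ℕ => ((n : ℝ) + 1)⁻¹) (x := atTop) <| tendsto_nhdsWithin_iff.2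
      ⟨by simpa using tendsto_add_inv_natCast 0, Eventually.of_forall fun n =>
        inv_ne_zero (Nat.cast_add_one_ne_zero n)⟩
  refine hslope.congr' ?_
  filter_upwards [(tendsto_add_inv_natCast t).eventually_mem (hI.mem_nhds ht)] with n hn
  simp only [Function.comp_apply, inv_inv, smul_eq_mul, h1 n hn, h2]

end AbsolutelyContinuousVersions

section Primitives

variable {I : Set ℝ} {h k : ℝ → ℝ} {a b c : ℝ}

lemma exists_mem_uIcc_subset [hI : OrdConnected I] (ha : a ∈ I) (hb : b ∈ I) (hc : c ∈ I) :
    ∃ l u, uIcc a b ⊆ uIcc l u ∧ c ∈ uIcc l u ∧ uIcc l u ⊆ I := by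
  have hl : min (min a b) c ∈ I := min_rec' (· ∈ I) (min_rec' (· ∈ I) ha hb) hc
  have hu : max (max a b) c ∈ I := max_rec' (· ∈ I) (max_rec' (· ∈ I) ha hb) hc
  refine ⟨_, _, ?_, ?_, hI.uIcc_subset hl hu⟩
  · rw [uIcc_of_le (b := max (max a b) c) (by simp)]
    exact Icc_subset_Icc (min_le_left _ _) (le_max_left _ _)
  · exact mem_uIcc_of_le (min_le_right _ _) (le_max_right _ _)

lemma hasACDeriv_primitive (hI : IsOpen I) [OrdConnected I] (hc : c ∈ I)
    (hk : ∀ a b, uIcc a b ⊆ I → IntervalIntegrable k volume a b) (d : ℝ) :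
    HasACDeriv I (fun t => d + ∫ s in c..t, k s) k := by
  refine ⟨_, ⟨fun a b hab => ?_, EventuallyEq.rfl⟩, ae_restrict_of_forall_uIcc hI fun a b hab => ?_⟩
  all_goals
    obtain ⟨l, u, hsub, hclu, hlu⟩ :=
      exists_mem_uIcc_subset (hab left_mem_uIcc) (hab right_mem_uIcc) hc
  · have hconst : AbsolutelyContinuousOnInterval (fun _ => d) l u :=
      (LipschitzWith.const d).lipschitzOnWith.absolutelyContinuousOnInterval
    exact (hconst.add ((hk l u hlu).absolutelyContinuousOnInterval_intervalIntegral hclu)).mono hsub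
  · filter_upwards [(hk l u hlu).ae_hasDerivAt_integral] with t ht htab
    exact (ht (hsub htab) c hclu).const_add d

lemma HasACDeriv.eqOn_acVersion_primitive (hI : IsOpen I) [hIc : OrdConnected I] (hc : c ∈ I)
    (H : HasACDeriv I h k) :
    EqOn (acVersion I h) (fun t => acVersion I h c + ∫ s in c..t, k s) I := by
  have hw := H.isACVersion_acVersion
  intro t ht
  simp only [hw.1.integral_eq_sub (H.ae_hasDerivAt hI hw) (hIc.uIcc_subset hc ht), add_sub_cancel]

lemma HasACDeriv.continuousOn_primitive (hI : IsOpen I) [OrdConnected I] (hc : c ∈ I)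
    (H : HasACDeriv I h k) : ContinuousOn (fun t => ∫ s in c..t, k s) I :=
  ((H.isACVersion_acVersion.1.continuousOn hI).sub continuousOn_const).congr fun _ ht =>
    eq_sub_of_add_eq' (H.eqOn_acVersion_primitive hI hc ht).symm

lemma HasACDeriv.hasDerivAt_acVersion_iff (hI : IsOpen I) [OrdConnected I] (hc : c ∈ I)
    (H : HasACDeriv I h k) {d t : ℝ} (ht : t ∈ I) :
    HasDerivAt (acVersion I h) d t ↔ HasDerivAt (fun t => ∫ s in c..t, k s) d t := by
  rw [((H.eqOn_acVersion_primitive hI hc).eventuallyEq_of_mem (hI.mem_nhds ht)).hasDerivAt_iff,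
    hasDerivAt_const_add_iff]

lemma hasACDeriv_of_tendsto (hI : IsOpen I) [hIc : OrdConnected I] {hn kn : ℕ → ℝ → ℝ}
    (H : ∀ n, HasACDeriv I (hn n) (kn n)) (hk : Measurable k)
    (hh : ∀ᵐ t ∂volume.restrict I, Tendsto (fun n => hn n t) atTop (𝓝 (h t)))
    (hkn : ∀ a b : ℝ, uIcc a b ⊆ I →
      Tendsto (fun n => ∫⁻ t in uIoc a b, ‖kn n t - k t‖ₑ) atTop (𝓝 0)) :
    HasACDeriv I h k := by
  rcases I.eq_empty_or_nonempty with rfl | hne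
  · exact ⟨h, ⟨fun a b hab => (hab left_mem_uIcc).elim, EventuallyEq.rfl⟩, by simp⟩
  choose w hw hwk using H
  have hknint (n : ℕ) {a b : ℝ} (hab : uIcc a b ⊆ I) : IntervalIntegrable (kn n) volume a b :=
    (hw n).1.intervalIntegrable (hwk n) hab
  have hkint : ∀ a b : ℝ, uIcc a b ⊆ I → IntervalIntegrable k volume a b := by
    intro a b hab
    obtain ⟨n, hfin⟩ := ((hkn a b hab).eventually (gt_mem_nhds ENNReal.zero_lt_top)).exists
    have hkn_n := intervalIntegrable_iff.1 (hknint n hab)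
    have hsub : IntegrableOn (fun t => kn n t - k t) (uIoc a b) :=
      ⟨hkn_n.aestronglyMeasurable.sub hk.aestronglyMeasurable, hfin⟩
    exact intervalIntegrable_iff.2 <| (hkn_n.sub hsub).congr <| .of_forall fun t => by simp
  have hall : ∀ᵐ t ∂volume.restrict I, Tendsto (fun n => w n t) atTop (𝓝 (h t)) := by
    filter_upwards [hh, ae_all_iff.2 fun n => (hw n).2] with t h1 h2
    exact h1.congr h2
  have : (ae (volume.restrict I)).NeBot :=
    ae_restrict_neBot.2 (hI.measure_pos volume hne).ne'
  obtain ⟨c, hc, hcI⟩ := (hall.and (ae_restrict_mem hI.measurableSet)).exists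
  refine (hasACDeriv_primitive hI hcI hkint (h c)).congr ?_ EventuallyEq.rfl
  filter_upwards [hall, ae_restrict_mem hI.measurableSet] with t ht htI
  have hct := hIc.uIcc_subset hcI htI
  have hlim : Tendsto (fun n => ∫ s in c..t, kn n s) atTop (𝓝 (∫ s in c..t, k s)) := by
    simp_rw [intervalIntegral.intervalIntegral_eq_integral_uIoc]
    exact (tendsto_integral_of_L1 k hk.aestronglyMeasurable (Eventually.of_forall fun n =>
      intervalIntegrable_iff.1 (hknint n hct)) (hkn c t hct)).const_smul _
  refine tendsto_nhds_unique ((hc.add hlim).congr fun n => ?_) ht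
  rw [(hw n).1.integral_eq_sub (hwk n) hct, add_sub_cancel]

lemma lintegral_enorm_le_weighted {α : Type*} [MeasurableSpace α] {μ : Measure α} {d : α → ℝ}
    {W : α → ℝ≥0∞} (hd : AEMeasurable d μ) (hW : AEMeasurable W μ)
    (hW0 : ∀ᵐ t ∂μ, W t ≠ 0) (hWt : ∀ᵐ t ∂μ, W t ≠ ⊤) :
    ∫⁻ t, ‖d t‖ₑ ∂μ ≤
      (∫⁻ t, ‖d t‖ₑ ^ 2 * W t ∂μ) ^ (1 / 2 : ℝ) * (∫⁻ t, (W t)⁻¹ ∂μ) ^ (1 / 2 : ℝ) := by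
  have hsq (a : ℝ≥0∞) : (a ^ (1 / 2 : ℝ)) ^ (2 : ℝ) = a := by
    rw [← ENNReal.rpow_mul]; norm_num
  calc ∫⁻ t, ‖d t‖ₑ ∂μ
      = ∫⁻ t, ‖d t‖ₑ * W t ^ (1 / 2 : ℝ) * (W t ^ (1 / 2 : ℝ))⁻¹ ∂μ := by
        refine lintegral_congr_ae ?_
        filter_upwards [hW0, hWt] with t h0 ht
        rw [mul_assoc, ENNReal.mul_inv_cancel (by simp [h0, ht]) (by simp [ht]), mul_one]
    _ ≤ (∫⁻ t, (‖d t‖ₑ * W t ^ (1 / 2 : ℝ)) ^ (2 : ℝ) ∂μ) ^ (1 / 2 : ℝ) *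
          (∫⁻ t, ((W t ^ (1 / 2 : ℝ))⁻¹) ^ (2 : ℝ) ∂μ) ^ (1 / 2 : ℝ) :=
        ENNReal.lintegral_mul_le_Lp_mul_Lq μ Real.HolderConjugate.two_two
          (hd.enorm.mul (hW.pow_const _)) (hW.pow_const _).inv
    _ = _ := by
        simp only [ENNReal.mul_rpow_of_nonneg _ _ zero_le_two, ← ENNReal.inv_rpow, hsq,
          ENNReal.rpow_two]

lemma hasACDeriv_of_tendsto_weighted (hI : IsOpen I) [OrdConnected I] {hn kn : ℕ → ℝ → ℝ}
    (H : ∀ n, HasACDeriv I (hn n) (kn n)) (hk : Measurable k) (hkm : ∀ n, Measurable (kn n))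
    (hh : ∀ᵐ t ∂volume.restrict I, Tendsto (fun n => hn n t) atTop (𝓝 (h t)))
    {W : ℝ → ℝ≥0∞} (hW : Measurable W) (hW0 : ∀ᵐ t ∂volume.restrict I, W t ≠ 0)
    (hWt : ∀ᵐ t ∂volume.restrict I, W t ≠ ⊤)
    (hWi : ∀ a b : ℝ, uIcc a b ⊆ I → ∫⁻ t in uIoc a b, (W t)⁻¹ ≠ ⊤)
    (hkn : Tendsto (fun n => ∫⁻ t in I, ‖kn n t - k t‖ₑ ^ 2 * W t) atTop (𝓝 0)) :
    HasACDeriv I h k := by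
  refine hasACDeriv_of_tendsto hI H hk hh fun a b hab => ?_
  have hsub : uIoc a b ⊆ I := uIoc_subset_uIcc.trans hab
  have hsqrt : Tendsto (fun n => (∫⁻ t in uIoc a b, ‖kn n t - k t‖ₑ ^ 2 * W t) ^ (1 / 2 : ℝ))
      atTop (𝓝 0) := by
    have hloc : Tendsto (fun n => ∫⁻ t in uIoc a b, ‖kn n t - k t‖ₑ ^ 2 * W t) atTop (𝓝 0) :=
      tendsto_of_tendsto_of_tendsto_of_le_of_le tendsto_const_nhds hkn
        (fun _ => zero_le) fun _ => lintegral_mono_set hsub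
    simpa [Function.comp_def] using
      (ENNReal.continuous_rpow_const (y := (1 / 2 : ℝ))).continuousAt.tendsto.comp hloc
  have hbound := ENNReal.Tendsto.mul_const (b := (∫⁻ t in uIoc a b, (W t)⁻¹) ^ (1 / 2 : ℝ)) hsqrt
    (Or.inr (by simp [hWi a b hab]))
  rw [zero_mul] at hbound
  exact tendsto_of_tendsto_of_tendsto_of_le_of_le tendsto_const_nhds hbound (fun _ => zero_le)
    fun n => lintegral_enorm_le_weighted ((hkm n).sub hk).aemeasurable hW.aemeasurable
      (ae_restrict_of_ae_restrict_of_subset hsub hW0)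
      (ae_restrict_of_ae_restrict_of_subset hsub hWt)

lemma exists_subset_Ioo_of_isCompact (hI : IsOpen I) [hIc : OrdConnected I] {K : Set ℝ}
    (hK : IsCompact K) (hne : K.Nonempty) (hKI : K ⊆ I) :
    ∃ a b, a < b ∧ K ⊆ Ioo a b ∧ uIcc a b ⊆ I := by
  obtain ⟨l, hlK, hl⟩ := hK.exists_isLeast hne
  obtain ⟨u, huK, hu⟩ := hK.exists_isGreatest hne
  obtain ⟨a, haI, hal⟩ := (((hI.eventually_mem (hKI hlK)).filter_mono
    nhdsWithin_le_nhds).and self_mem_nhdsWithin : ∀ᶠ a in 𝓝[<] l, _).exists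
  obtain ⟨b, hbI, hub⟩ := (((hI.eventually_mem (hKI huK)).filter_mono
    nhdsWithin_le_nhds).and self_mem_nhdsWithin : ∀ᶠ b in 𝓝[>] u, _).exists
  exact ⟨a, b, (mem_Iio.1 hal).trans_le ((hl huK).trans (mem_Ioi.1 hub).le),
    fun t ht => ⟨(mem_Iio.1 hal).trans_le (hl ht), (hu ht).trans_lt hub⟩,
    hIc.uIcc_subset haI hbI⟩

lemma HasACDeriv.setIntegral_mul_eq_neg (hI : IsOpen I) [OrdConnected I] (H : HasACDeriv I h k)
    {P : ℝ → ℝ} (hP : ContDiff ℝ 1 P) (hPc : HasCompactSupport P) (hPI : tsupport P ⊆ I) :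
    ∫ t in I, P t * k t = -∫ t in I, deriv P t * h t := by
  rcases (tsupport P).eq_empty_or_nonempty with he | hne
  · obtain rfl : P = 0 := tsupport_eq_empty_iff.1 he
    simp
  obtain ⟨w, hw, hwk⟩ := H
  obtain ⟨a, b, hab, hPab, habI⟩ := exists_subset_Ioo_of_isCompact hI hPc hne hPI
  have hreduce (Q F : ℝ → ℝ) (hQ : tsupport Q ⊆ tsupport P) :
      ∫ t in I, Q t * F t = ∫ t in a..b, Q t * F t := by
    rw [intervalIntegral.integral_of_le hab.le]
    refine setIntegral_eq_of_subset_of_forall_sdiff_eq_zero hI.measurableSet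
      (uIoc_of_le hab.le ▸ uIoc_subset_uIcc.trans habI) fun t ht => ?_
    rw [image_eq_zero_of_notMem_tsupport fun h => ht.2 (Ioo_subset_Ioc_self (hPab (hQ h))),
      zero_mul]
  have hPa : P a = 0 := image_eq_zero_of_notMem_tsupport fun hx => lt_irrefl _ (hPab hx).1
  have hPb : P b = 0 := image_eq_zero_of_notMem_tsupport fun hx => lt_irrefl _ (hPab hx).2
  rw [hreduce P k Subset.rfl, hreduce _ h (tsupport_deriv_subset (𝕜 := ℝ))]
  calc ∫ t in a..b, P t * k t = ∫ t in a..b, P t * deriv w t :=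
        intervalIntegral.integral_congr_ae_restrict <|
          (ae_restrict_uIoc_of_ae_restrict hwk habI).mono fun t ht => by simp only [ht.deriv]
    _ = -∫ t in a..b, deriv P t * w t := by
        rw [AbsolutelyContinuousOnInterval.integral_mul_deriv_eq_deriv_mul
          hP.contDiffOn.absolutelyContinuousOnInterval (hw.1 a b habI), hPa, hPb]
        ring
    _ = -∫ t in a..b, deriv P t * h t :=
        congrArg Neg.neg <| intervalIntegral.integral_congr_ae_restrict <|
          (ae_restrict_uIoc_of_ae_restrict hw.2 habI).mono fun t ht => by simp only [ht]

end Primitives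

section AlmostAllLines

/-! ### Derivatives along almost all lines of a product -/

lemma tendsto_nhdsWithin_of_tendsto_comap {ι X Y : Type*} [TopologicalSpace X]
    [TopologicalSpace Y] [RegularSpace Y] {e : ι → X} (he : DenseRange e) {φ : X → Y} {s : Set X}
    (hs : IsOpen s) {x : X} {y : Y} (hφ : ∀ᶠ z in 𝓝[s] x, ContinuousAt φ z)
    (h : Tendsto (φ ∘ e) (comap e (𝓝[s] x)) (𝓝 y)) : Tendsto φ (𝓝[s] x) (𝓝 y) := by
  refine (closed_nhds_basis y).tendsto_right_iff.2 fun C ⟨hCy, hC⟩ => ?_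
  have hdense : ∀ᶠ z in 𝓝[s] x, ∀ i, e i = z → φ (e i) ∈ C := eventually_comap.1 (h hCy)
  filter_upwards [eventually_eventually_nhdsWithin.2 hdense, hφ, self_mem_nhdsWithin]
    with z hz hcont hzs
  rw [hs.nhdsWithin_eq hzs] at hz
  have : (comap e (𝓝 z)).NeBot := comap_neBot fun t ht => by
    obtain ⟨_, hit, i, rfl⟩ := mem_closure_iff_nhds.1 (he z) t ht
    exact ⟨i, hit⟩
  exact hC.mem_of_tendsto (hcont.tendsto.comp tendsto_comap)
    (eventually_comap.2 (hz.mono fun w hw i hi => hw i hi))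

variable {α : Type*} [MeasurableSpace α] {ν : Measure α} {I : Set ℝ} {u v g g' : α × ℝ → ℝ}

/-- For `ν`-almost every `x`, the function `t ↦ u (x, t)` has an absolutely continuous version on
`I` with derivative `t ↦ g (x, t)`. -/
def HasACDerivAlong (ν : Measure α) (I : Set ℝ) (u g : α × ℝ → ℝ) : Prop :=
  ∀ᵐ x ∂ν, HasACDeriv I (fun t => u (x, t)) fun t => g (x, t)

namespace HasACDerivAlong

protected lemma congr (H : HasACDerivAlong ν I u g) (huv : u =ᵐ[ν.prod (volume.restrict I)] v) :
    HasACDerivAlong ν I v g := by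
  filter_upwards [H, Measure.ae_ae_of_ae_prod huv] with x hx hxuv
  exact hx.congr hxuv EventuallyEq.rfl

protected lemma add (H : HasACDerivAlong ν I u g) (H' : HasACDerivAlong ν I v g') :
    HasACDerivAlong ν I (fun p => u p + v p) fun p => g p + g' p := by
  filter_upwards [H, H'] with x h1 h2 using h1.add h2

protected lemma const_mul (c : ℝ) (H : HasACDerivAlong ν I u g) :
    HasACDerivAlong ν I (fun p => c * u p) fun p => c * g p := by
  filter_upwards [H] with x hx using hx.const_mul c

lemma unitClamp_comp (hI : IsOpen I) (H : HasACDerivAlong ν I u g) :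
    HasACDerivAlong ν I (fun p => unitClamp (u p))
      fun p => (Ioo (0 : ℝ) 1).indicator 1 (u p) * g p := by
  filter_upwards [H] with x hx using hx.unitClamp_comp hI

lemma ae_exists_isACVersion (H : HasACDerivAlong ν I u g) :
    ∀ᵐ x ∂ν, ∃ w, IsACVersion I (fun t => u (x, t)) w := by
  filter_upwards [H] with x ⟨w, hw, _⟩ using ⟨w, hw⟩

end HasACDerivAlong

lemma exists_measurable_hasACDerivAlong (hI : IsOpen I) (hu : Measurable u)
    (h : ∀ᵐ x ∂ν, ∃ w, IsACVersion I (fun t => u (x, t)) w) :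
    ∃ g, Measurable g ∧ HasACDerivAlong ν I u g := by
  refine ⟨fun p => limsup (fun n : ℕ => ((n : ℝ) + 1) *
    (u (p.1, p.2 + ((n : ℝ) + 1)⁻¹) - u p)) atTop, .limsup fun n => by fun_prop, ?_⟩
  filter_upwards [h] with x ⟨w, hw⟩
  refine (hw.hasACDeriv hI).congr EventuallyEq.rfl ?_
  filter_upwards [(hw.hasACDeriv hI).ae_tendsto_slope hI] with t ht using ht.limsup_eq.symm

lemma measurable_primitive (hg : Measurable g) (c : ℝ) :
    Measurable fun p : α × ℝ => ∫ s in c..p.2, g (p.1, s) := by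
  have hscale (p : α × ℝ) : ∫ s in c..p.2, g (p.1, s) =
      (p.2 - c) * ∫ s in Ioc 0 1, g (p.1, (p.2 - c) * s + c) := by
    rw [← intervalIntegral.integral_of_le zero_le_one, ← smul_eq_mul,
      intervalIntegral.smul_integral_comp_mul_add (f := fun s => g (p.1, s))]
    simp
  simp_rw [hscale]
  have hcomp : Measurable fun q : (α × ℝ) × ℝ => g (q.1.1, (q.1.2 - c) * q.2 + c) := by fun_prop
  exact (by fun_prop : Measurable fun p : α × ℝ => p.2 - c).mul
    hcomp.stronglyMeasurable.integral_prod_right'.measurable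

lemma measurableSet_tendsto_slope_rat {F : α × ℝ → ℝ} (hF : Measurable F) (hg : Measurable g) :
    MeasurableSet {p : α × ℝ | Tendsto (fun q : ℚ => (q : ℝ)⁻¹ • (F (p.1, p.2 + q) - F p) - g p)
      (comap (↑) (𝓝[≠] (0 : ℝ))) (𝓝 0)} :=
  measurableSet_tendsto _ fun q => by fun_prop

lemma hasDerivAt_iff_tendsto_slope_rat {f : ℝ → ℝ} {d t : ℝ} (hf : ∀ᶠ s in 𝓝 t, ContinuousAt f s) :
    HasDerivAt f d t ↔ Tendsto (fun q : ℚ => (q : ℝ)⁻¹ • (f (t + q) - f t) - d)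
      (comap (↑) (𝓝[≠] (0 : ℝ))) (𝓝 0) := by
  rw [hasDerivAt_iff_tendsto_slope_zero, tendsto_sub_nhds_zero_iff]
  refine ⟨fun h => h.comp tendsto_comap, fun h => tendsto_nhdsWithin_of_tendsto_comap
    (φ := fun s => s⁻¹ • (f (t + s) - f t)) Rat.denseRange_cast isOpen_compl_singleton ?_ h⟩
  have hshift : ∀ᶠ s in 𝓝 (0 : ℝ), ContinuousAt f (t + s) :=
    (continuous_const_add t).continuousAt.eventually (by simpa using hf)
  filter_upwards [hshift.filter_mono nhdsWithin_le_nhds, self_mem_nhdsWithin] with s hs hs0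
  have : ContinuousAt (fun r => f (t + r)) s := ContinuousAt.comp hs (by fun_prop)
  exact (continuousAt_inv₀ hs0).smul (this.sub continuousAt_const)

lemma HasACDerivAlong.deriv_acVersion_ae_eq (hI : IsOpen I) [hIc : OrdConnected I]
    (hg : Measurable g) (H : HasACDerivAlong ν I u g) :
    ∀ᵐ p ∂ν.prod (volume.restrict I), deriv (acVersion I fun t => u (p.1, t)) p.2 = g p := by
  rcases I.eq_empty_or_nonempty with rfl | ⟨c, hc⟩
  · simp
  -- `acVersion` need not be jointly measurable; a primitive of `g` is, so Fubini applies to it.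
  let F (p : α × ℝ) : ℝ := ∫ s in c..p.2, g (p.1, s)
  have hcont : ∀ᵐ x ∂ν, ∀ t ∈ I, ∀ᶠ s in 𝓝 t, ContinuousAt (fun t => F (x, t)) s := by
    filter_upwards [H] with x hx t ht
    filter_upwards [hI.mem_nhds ht] with s hs
      using (hx.continuousOn_primitive hI hc).continuousAt (hI.mem_nhds hs)
  have hslope : ∀ᵐ p ∂ν.prod (volume.restrict I), p ∈ {p : α × ℝ | Tendsto
      (fun q : ℚ => (q : ℝ)⁻¹ • (F (p.1, p.2 + q) - F p) - g p)
      (comap (↑) (𝓝[≠] (0 : ℝ))) (𝓝 0)} := by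
    rw [Measure.ae_prod_mem_iff_ae_ae_mem
      (measurableSet_tendsto_slope_rat (measurable_primitive hg c) hg)]
    filter_upwards [H, hcont] with x hx hxc
    filter_upwards [hx.ae_hasDerivAt hI hx.isACVersion_acVersion, ae_restrict_mem hI.measurableSet]
      with t ht htI
    exact (hasDerivAt_iff_tendsto_slope_rat (hxc t htI)).1
      ((hx.hasDerivAt_acVersion_iff hI hc htI).1 ht)
  filter_upwards [hslope, Measure.quasiMeasurePreserving_fst.ae (H.and hcont),
    Measure.quasiMeasurePreserving_snd.ae (ae_restrict_mem hI.measurableSet)]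
    with p hp ⟨hx, hxc⟩ hpI
  exact ((hx.hasDerivAt_acVersion_iff hI hc hpI).2
    ((hasDerivAt_iff_tendsto_slope_rat (hxc p.2 hpI)).2 hp)).deriv

lemma enorm_mul_sq_mul_ofReal (c d m : ℝ) :
    ‖c * d‖ₑ ^ 2 * ENNReal.ofReal m = ‖d‖ₑ ^ 2 * ENNReal.ofReal (c ^ 2 * m) := by
  rw [enorm_mul, mul_pow, ENNReal.ofReal_mul (sq_nonneg c), Real.enorm_eq_ofReal_abs c,
    ← ENNReal.ofReal_pow (abs_nonneg c), sq_abs]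
  ring

lemma HasACDerivAlong.of_tsum (hI : IsOpen I) [OrdConnected I]
    {un gn : ℕ → α × ℝ → ℝ} {c m : α × ℝ → ℝ}
    (H : ∀ n, HasACDerivAlong ν I (un n) (gn n)) (hg : Measurable g) (hgn : ∀ n, Measurable (gn n))
    (hu : ∀ᵐ p ∂ν.prod (volume.restrict I), Tendsto (fun n => un n p) atTop (𝓝 (u p)))
    (hc : Measurable c) (hm : Measurable m)
    (hcm : ∀ᵐ p ∂ν.prod (volume.restrict I), 0 < c p ^ 2 * m p)
    (hcmi : ∀ᵐ x ∂ν, ∀ a b : ℝ, uIcc a b ⊆ I →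
      IntervalIntegrable (fun t => (c (x, t) ^ 2 * m (x, t))⁻¹) volume a b)
    (hsum : ∑' n, ∫⁻ p, ‖c p * gn n p - c p * g p‖ₑ ^ 2 * ENNReal.ofReal (m p)
      ∂ν.prod (volume.restrict I) ≠ ⊤) :
    HasACDerivAlong ν I u g := by
  let W (p : α × ℝ) : ℝ≥0∞ := ENNReal.ofReal (c p ^ 2 * m p)
  have hW : Measurable W := ((hc.pow_const 2).mul hm).ennreal_ofReal
  have hmeas (n : ℕ) : Measurable fun p => ‖gn n p - g p‖ₑ ^ 2 * W p :=
    (((hgn n).sub hg).enorm.pow_const 2).mul hW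
  have hsumW : ∑' n, ∫⁻ p, ‖gn n p - g p‖ₑ ^ 2 * W p ∂ν.prod (volume.restrict I) ≠ ⊤ := by
    simpa only [W, ← mul_sub, enorm_mul_sq_mul_ofReal] using hsum
  have hlines : ∀ᵐ x ∂ν, ∑' n, ∫⁻ t in I, ‖gn n (x, t) - g (x, t)‖ₑ ^ 2 * W (x, t) < ⊤ := by
    refine ae_lt_top (.tsum fun n => (hmeas n).lintegral_prod_right') ?_
    rw [lintegral_tsum fun n => (hmeas n).lintegral_prod_right'.aemeasurable]
    exact ne_of_eq_of_ne (tsum_congr fun n => (lintegral_prod _ (hmeas n).aemeasurable).symm) hsumW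
  filter_upwards [ae_all_iff.2 H, Measure.ae_ae_of_ae_prod hu, Measure.ae_ae_of_ae_prod hcm,
    hcmi, hlines] with x hH hux hcmx hcmix hsumx
  refine hasACDeriv_of_tendsto_weighted hI hH (hg.comp measurable_prodMk_left)
    (fun n => (hgn n).comp measurable_prodMk_left) hux (hW.comp measurable_prodMk_left)
    (hcmx.mono fun t ht => (ENNReal.ofReal_pos.2 ht).ne')
    (.of_forall fun t => ENNReal.ofReal_ne_top) (fun a b hab => ?_)
    (ENNReal.tendsto_atTop_zero_of_tsum_ne_top hsumx.ne)
  refine ne_of_eq_of_ne (lintegral_congr_ae ?_) (intervalIntegrable_iff.1 (hcmix a b hab)).2.ne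
  filter_upwards [ae_restrict_uIoc_of_ae_restrict hcmx hab] with t ht
  rw [Real.enorm_of_nonneg (inv_nonneg.2 ht.le), ENNReal.ofReal_inv_of_pos ht, Function.comp_apply]

lemma HasACDerivAlong.integral_mul_eq_neg [SFinite ν] (hI : IsOpen I) [OrdConnected I]
    (H : HasACDerivAlong ν I u g) {P : α × ℝ → ℝ}
    (hP : ∀ᵐ x ∂ν, ContDiff ℝ 1 fun t => P (x, t))
    (hPc : ∀ᵐ x ∂ν, HasCompactSupport fun t => P (x, t))
    (hPI : ∀ᵐ x ∂ν, tsupport (fun t => P (x, t)) ⊆ I)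
    (hPg : Integrable (fun p => P p * g p) (ν.prod (volume.restrict I)))
    (hPu : Integrable (fun p => deriv (fun t => P (p.1, t)) p.2 * u p)
      (ν.prod (volume.restrict I))) :
    ∫ p, P p * g p ∂ν.prod (volume.restrict I) =
      -∫ p, deriv (fun t => P (p.1, t)) p.2 * u p ∂ν.prod (volume.restrict I) := by
  rw [integral_prod _ hPg, integral_prod _ hPu, ← integral_neg]
  refine integral_congr_ae ?_
  filter_upwards [H, hP, hPc, hPI] with x hx hPx hPcx hPIx
    using hx.setIntegral_mul_eq_neg hI hPx hPcx hPIx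

end AlmostAllLines

section SpeedMeasure

/-! ### The speed measure -/

variable {ρ β : ℝ} {j : ℕ}

lemma isOpen_halfPlane : IsOpen halfPlane := isOpen_lt continuous_const continuous_snd

lemma measurableSet_halfPlane : MeasurableSet halfPlane := isOpen_halfPlane.measurableSet

lemma isOpen_quadrant : IsOpen quadrant :=
  (isOpen_lt continuous_const continuous_fst).inter (isOpen_lt continuous_const continuous_snd)

lemma quadrant_subset_halfPlane : quadrant ⊆ halfPlane := fun _ hp => hp.2

lemma volume_restrict_halfPlane :
    (volume : Measure (ℝ × ℝ)).restrict halfPlane = volume.prod (volume.restrict (Ioi 0)) := by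
  have hprod : halfPlane = univ ×ˢ Ioi (0 : ℝ) := by ext p; simp [halfPlane]
  rw [hprod, Measure.volume_eq_prod, ← Measure.prod_restrict, Measure.restrict_univ]

lemma measurePreserving_swap_halfPlane :
    MeasurePreserving Prod.swap ((volume.restrict (Ioi (0 : ℝ))).prod (volume.restrict univ))
      (volume.restrict halfPlane) := by
  rw [volume_restrict_halfPlane, Measure.restrict_univ]
  exact Measure.measurePreserving_swap

lemma ae_swap_halfPlane {P : ℝ × ℝ → Prop}
    (hP : ∀ᵐ p ∂(volume.restrict (Ioi (0 : ℝ))).prod (volume.restrict univ), P p) :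
    ∀ᵐ p ∂volume.restrict halfPlane, P p.swap := by
  rw [volume_restrict_halfPlane]
  rw [Measure.restrict_univ] at hP
  exact Measure.measurePreserving_swap.quasiMeasurePreserving.ae hP

lemma ae_fst_ne_zero : ∀ᵐ p ∂volume.restrict halfPlane, (p : ℝ × ℝ).1 ≠ 0 := by
  rw [volume_restrict_halfPlane]
  exact Measure.quasiMeasurePreserving_fst.ae (Measure.ae_ne volume 0)

/-- The density `m_j` of the speed measure. -/
def speedDensity (ρ β : ℝ) (j : ℕ) (p : ℝ × ℝ) : ℝ :=
  1 / (√(1 - ρ ^ 2) * |p.1| ^ (β * (1 + j)) * p.2 ^ 2)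

@[fun_prop]
lemma measurable_speedDensity : Measurable (speedDensity ρ β j) := by
  unfold speedDensity; fun_prop

lemma speedDensity_nonneg (p : ℝ × ℝ) : 0 ≤ speedDensity ρ β j p := by
  unfold speedDensity; positivity

lemma sqrt_one_sub_sq_pos (hρ : -1 < ρ ∧ ρ < 1) : 0 < √(1 - ρ ^ 2) :=
  Real.sqrt_pos.2 (by nlinarith [hρ.1, hρ.2])

lemma speedDensity_pos (hρ : -1 < ρ ∧ ρ < 1) {p : ℝ × ℝ} (hx : p.1 ≠ 0) (hy : p.2 ≠ 0) :
    0 < speedDensity ρ β j p := by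
  have := sqrt_one_sub_sq_pos hρ
  unfold speedDensity
  positivity

lemma speedMeasure_eq_withDensity : speedMeasure ρ β j =
    (volume.restrict halfPlane).withDensity fun p => ENNReal.ofReal (speedDensity ρ β j p) := rfl

lemma ae_speedMeasure (hρ : -1 < ρ ∧ ρ < 1) :
    ae (speedMeasure ρ β j) = ae (volume.restrict halfPlane) := by
  refine le_antisymm (withDensity_absolutelyContinuous _ _).ae_le
    (withDensity_absolutelyContinuous' (by fun_prop) ?_).ae_le
  filter_upwards [ae_fst_ne_zero, ae_restrict_mem measurableSet_halfPlane] with p hx hy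
  exact (ENNReal.ofReal_pos.2 (speedDensity_pos hρ hx (ne_of_gt hy))).ne'

lemma lintegral_speedMeasure {f : ℝ × ℝ → ℝ≥0∞} (hf : Measurable f) :
    ∫⁻ p, f p ∂speedMeasure ρ β j =
      ∫⁻ p in halfPlane, f p * ENNReal.ofReal (speedDensity ρ β j p) := by
  rw [speedMeasure_eq_withDensity, lintegral_withDensity_eq_lintegral_mul _ (by fun_prop) hf]
  simp only [Pi.mul_apply, mul_comm]

lemma integral_speedMeasure (f : ℝ × ℝ → ℝ) :
    ∫ p, f p ∂speedMeasure ρ β j = ∫ p in halfPlane, speedDensity ρ β j p * f p := by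
  rw [speedMeasure_eq_withDensity, integral_withDensity_eq_integral_toReal_smul (by fun_prop)
    (.of_forall fun _ => ENNReal.ofReal_lt_top)]
  simp only [ENNReal.toReal_ofReal (speedDensity_nonneg _), smul_eq_mul]

lemma integrable_speedMeasure_iff {f : ℝ × ℝ → ℝ} :
    Integrable f (speedMeasure ρ β j) ↔
      IntegrableOn (fun p => speedDensity ρ β j p * f p) halfPlane := by
  rw [speedMeasure_eq_withDensity, integrable_withDensity_iff_integrable_smul' (by fun_prop)
    (.of_forall fun _ => ENNReal.ofReal_lt_top)]
  simp only [ENNReal.toReal_ofReal (speedDensity_nonneg _), smul_eq_mul, IntegrableOn]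

end SpeedMeasure

section GraphForms

/-! ### Forms represented by a closed graph -/

variable {H K : Type*} [NormedAddCommGroup H] [InnerProductSpace ℝ H]
  [NormedAddCommGroup K] [NormedSpace ℝ K] {D : Set H} {E : H → H → ℝ}
  {G : Submodule ℝ (H × K)} {B : LinearMap.BilinForm ℝ K}

lemma cauchySeq_of_mul_norm_sq_le {V : Type*} [SeminormedAddCommGroup V] {u : ℕ → V} {c : ℝ}
    {d : ℕ → ℕ → ℝ} (hc : 0 < c) (hd : ∀ ε > 0, ∃ N, ∀ m ≥ N, ∀ n ≥ N, d m n < ε)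
    (hle : ∀ m n, c * ‖u m - u n‖ ^ 2 ≤ d m n) : CauchySeq u := by
  refine Metric.cauchySeq_iff.2 fun ε hε => ?_
  obtain ⟨N, hN⟩ := hd (c * ε ^ 2) (by positivity)
  refine ⟨N, fun m hm n hn => ?_⟩
  rw [dist_eq_norm]
  exact lt_of_pow_lt_pow_left₀ 2 hε.le
    (lt_of_mul_lt_mul_left ((hle m n).trans_lt (hN m hm n hn)) hc.le)

/-- The form `(E, D)` is `E(u,v) = B(Tu,Tv)` with `D = D(T)`, where `T` is the (possibly
multivalued) linear operator from `H` to `K` with graph `G`. -/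
structure IsGraphForm (G : Submodule ℝ (H × K)) (B : LinearMap.BilinForm ℝ K) (D : Set H)
    (E : H → H → ℝ) : Prop where
  mem_iff : ∀ {u}, u ∈ D ↔ ∃ k, (u, k) ∈ G
  eq_apply : ∀ {u v k l}, (u, k) ∈ G → (v, l) ∈ G → E u v = B k l

namespace IsGraphForm

lemma isSymmetricForm (h : IsGraphForm G B D E) (hD : Dense D) (hsymm : ∀ k l, B k l = B l k)
    (hnonneg : ∀ k, 0 ≤ B k k) : IsSymmetricForm D E where
  zero_mem := h.mem_iff.2 ⟨0, G.zero_mem⟩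
  add_mem u hu v hv := by
    obtain ⟨k, hk⟩ := h.mem_iff.1 hu
    obtain ⟨l, hl⟩ := h.mem_iff.1 hv
    exact h.mem_iff.2 ⟨k + l, G.add_mem hk hl⟩
  smul_mem c u hu := by
    obtain ⟨k, hk⟩ := h.mem_iff.1 hu
    exact h.mem_iff.2 ⟨c • k, G.smul_mem c hk⟩
  dense := hD
  add_left u₁ hu₁ u₂ hu₂ v hv := by
    obtain ⟨k₁, hk₁⟩ := h.mem_iff.1 hu₁
    obtain ⟨k₂, hk₂⟩ := h.mem_iff.1 hu₂
    obtain ⟨l, hl⟩ := h.mem_iff.1 hv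
    rw [h.eq_apply (G.add_mem hk₁ hk₂) hl, h.eq_apply hk₁ hl, h.eq_apply hk₂ hl, map_add,
      LinearMap.add_apply]
  smul_left c u hu v hv := by
    obtain ⟨k, hk⟩ := h.mem_iff.1 hu
    obtain ⟨l, hl⟩ := h.mem_iff.1 hv
    rw [h.eq_apply (G.smul_mem c hk) hl, h.eq_apply hk hl, map_smul, LinearMap.smul_apply,
      smul_eq_mul]
  symm u hu v hv := by
    obtain ⟨k, hk⟩ := h.mem_iff.1 hu
    obtain ⟨l, hl⟩ := h.mem_iff.1 hv
    rw [h.eq_apply hk hl, h.eq_apply hl hk, hsymm]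
  nonneg u hu := by
    obtain ⟨k, hk⟩ := h.mem_iff.1 hu
    rw [h.eq_apply hk hk]
    exact hnonneg k

lemma normE1Sq_sub (h : IsGraphForm G B D E) {u v : H} {k l : K} (hu : (u, k) ∈ G)
    (hv : (v, l) ∈ G) : normE1Sq E (u - v) = B (k - l) (k - l) + ‖u - v‖ ^ 2 := by
  have hsub := G.sub_mem hu hv
  rw [normE1Sq, h.eq_apply hsub hsub]

lemma isClosedForm [CompleteSpace H] [CompleteSpace K] (h : IsGraphForm G B D E) (hD : Dense D)
    (hG : IsClosed (G : Set (H × K))) (hsymm : ∀ k l, B k l = B l k) {c C : ℝ} (hc : 0 < c)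
    (hlower : ∀ k, c * ‖k‖ ^ 2 ≤ B k k) (hupper : ∀ k, B k k ≤ C * ‖k‖ ^ 2) :
    IsClosedForm D E where
  toIsSymmetricForm := h.isSymmetricForm hD hsymm fun k => le_trans (by positivity) (hlower k)
  complete u hu hcauchy := by
    choose k hk using fun n => h.mem_iff.1 (hu n)
    have hnonneg : ∀ l, 0 ≤ B l l := fun l => le_trans (by positivity) (hlower l)
    have hcauchy_u : CauchySeq u := by
      refine cauchySeq_of_mul_norm_sq_le one_pos hcauchy fun m n => ?_
      rw [h.normE1Sq_sub (hk m) (hk n)]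
      linarith [hnonneg (k m - k n)]
    have hcauchy_k : CauchySeq k := by
      refine cauchySeq_of_mul_norm_sq_le hc hcauchy fun m n => ?_
      rw [h.normE1Sq_sub (hk m) (hk n)]
      linarith [hlower (k m - k n), sq_nonneg ‖u m - u n‖]
    obtain ⟨v, hv⟩ := cauchySeq_tendsto_of_complete hcauchy_u
    obtain ⟨l, hl⟩ := cauchySeq_tendsto_of_complete hcauchy_k
    have hvl : (v, l) ∈ G :=
      hG.mem_of_tendsto (hv.prodMk_nhds hl) (Eventually.of_forall hk)
    have hlim : Tendsto (fun n => C * ‖k n - l‖ ^ 2 + ‖u n - v‖ ^ 2) atTop (𝓝 0) := by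
      simpa using (((tendsto_iff_norm_sub_tendsto_zero.1 hl).pow 2).const_mul C).add
        ((tendsto_iff_norm_sub_tendsto_zero.1 hv).pow 2)
    refine ⟨v, h.mem_iff.2 ⟨l, hvl⟩, squeeze_zero (fun n => ?_) (fun n => ?_) hlim⟩
    · rw [h.normE1Sq_sub (hk n) hvl]
      linarith [hnonneg (k n - l), sq_nonneg ‖u n - v‖]
    · rw [h.normE1Sq_sub (hk n) hvl]
      linarith [hupper (k n - l)]

end IsGraphForm

lemma IsSymmetricForm.restrict (h : IsSymmetricForm D E) {p : Submodule ℝ H}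
    (hp : (p : Set H) ⊆ D) (hdense : Dense (p : Set H)) : IsSymmetricForm p E where
  zero_mem := p.zero_mem
  add_mem _ hu _ hv := p.add_mem hu hv
  smul_mem c _ hu := p.smul_mem c hu
  dense := hdense
  add_left _ hu₁ _ hu₂ _ hv := h.add_left _ (hp hu₁) _ (hp hu₂) _ (hp hv)
  smul_left c _ hu _ hv := h.smul_left c _ (hp hu) _ (hp hv)
  symm _ hu _ hv := h.symm _ (hp hu) _ (hp hv)
  nonneg _ hu := h.nonneg _ (hp hu)

lemma IsClosedForm.isClosable_of_subset {D' : Set H} (h : IsClosedForm D' E) (hD : D ⊆ D') :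
    IsClosable D E :=
  ⟨D', E, h, hD, fun _ _ _ _ => rfl⟩

lemma generator_eq (hD : Dense D) {u w : H} (hw : ∀ v ∈ D, E u v = -inner ℝ w v) :
    generator D E u = w := by
  have hgen : ∀ v ∈ D, E u v = -inner ℝ (generator D E u) v :=
    Classical.epsilon_spec (p := fun w : H => ∀ v ∈ D, E u v = -inner ℝ w v) ⟨w, hw⟩
  exact hD.eq_of_inner_left ℝ fun v hv => neg_injective ((hgen v hv).symm.trans (hw v hv))

end GraphForms

section Gradients

/-! ### Gradients -/

variable {f u v : ℝ × ℝ → ℝ} {g h : ℝ × ℝ → ℝ × ℝ}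

lemma hasDerivAt_partialX (hf : Differentiable ℝ f) (p : ℝ × ℝ) :
    HasDerivAt (fun s => f (s, p.2)) (fderiv ℝ f p (1, 0)) p.1 :=
  (hf p).hasFDerivAt.comp_hasDerivAt (f := fun s => (s, p.2)) p.1
    ((hasDerivAt_id p.1).prodMk (hasDerivAt_const p.1 p.2))

lemma hasDerivAt_partialY (hf : Differentiable ℝ f) (p : ℝ × ℝ) :
    HasDerivAt (fun t => f (p.1, t)) (fderiv ℝ f p (0, 1)) p.2 :=
  (hf p).hasFDerivAt.comp_hasDerivAt (f := fun t => (p.1, t)) p.2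
    ((hasDerivAt_const p.2 p.1).prodMk (hasDerivAt_id p.2))

lemma partialX_eq_fderiv (hf : Differentiable ℝ f) : partialX f = fun p => fderiv ℝ f p (1, 0) :=
  funext fun p => (hasDerivAt_partialX hf p).deriv

lemma partialY_eq_fderiv (hf : Differentiable ℝ f) : partialY f = fun p => fderiv ℝ f p (0, 1) :=
  funext fun p => (hasDerivAt_partialY hf p).deriv

/-- `g` is a gradient of `u` on the half-plane, formed with the derivatives of the absolutely
continuous versions of `u` on almost all lines parallel to the axes. The coordinates are swapped
in `fst` because `HasACDerivAlong` differentiates in the second variable. -/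
structure HasGrad (u : ℝ × ℝ → ℝ) (g : ℝ × ℝ → ℝ × ℝ) : Prop where
  measurable : Measurable g
  fst : HasACDerivAlong (volume.restrict (Ioi 0)) univ (fun p => u p.swap) fun p => (g p.swap).1
  snd : HasACDerivAlong volume (Ioi 0) u fun p => (g p).2

namespace HasGrad

protected lemma congr (H : HasGrad u g) (huv : u =ᵐ[volume.restrict halfPlane] v) :
    HasGrad v g where
  measurable := H.measurable
  fst := H.fst.congr (measurePreserving_swap_halfPlane.quasiMeasurePreserving.ae huv)
  snd := H.snd.congr (volume_restrict_halfPlane ▸ huv)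

protected lemma add (H : HasGrad u g) (H' : HasGrad v h) :
    HasGrad (fun p => u p + v p) (fun p => g p + h p) :=
  ⟨H.measurable.add H'.measurable, H.fst.add H'.fst, H.snd.add H'.snd⟩

protected lemma const_mul (c : ℝ) (H : HasGrad u g) :
    HasGrad (fun p => c * u p) (fun p => c • g p) :=
  ⟨H.measurable.const_smul c, H.fst.const_mul c, H.snd.const_mul c⟩

lemma unitClamp_comp (hu : Measurable u) (H : HasGrad u g) :
    HasGrad (fun p => unitClamp (u p))
      (fun p => (Ioo (0 : ℝ) 1).indicator (1 : ℝ → ℝ) (u p) • g p) where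
  measurable :=
    ((measurable_one.indicator measurableSet_Ioo).comp hu : Measurable fun p =>
      (Ioo (0 : ℝ) 1).indicator (1 : ℝ → ℝ) (u p)).smul H.measurable
  fst := H.fst.unitClamp_comp isOpen_univ
  snd := H.snd.unitClamp_comp isOpen_Ioi

lemma acGradient_ae_eq (H : HasGrad u g) : acGradient u =ᵐ[volume.restrict halfPlane] g := by
  have hfst := ae_swap_halfPlane
    (H.fst.deriv_acVersion_ae_eq isOpen_univ (H.measurable.comp measurable_swap).fst)
  have hsnd := H.snd.deriv_acVersion_ae_eq isOpen_Ioi H.measurable.snd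
  rw [← volume_restrict_halfPlane] at hsnd
  filter_upwards [hfst, hsnd] with p hp_fst hp_snd
  exact Prod.ext hp_fst hp_snd

end HasGrad

lemma exists_hasGrad (hu : Measurable u)
    (hx : ∀ᵐ y ∂volume.restrict (Ioi (0 : ℝ)), ∃ w, IsACVersion univ (fun s => u (s, y)) w)
    (hy : ∀ᵐ x ∂(volume : Measure ℝ), ∃ w, IsACVersion (Ioi 0) (fun t => u (x, t)) w) :
    ∃ g, HasGrad u g := by
  obtain ⟨g₁, hg₁, hfst⟩ := exists_measurable_hasACDerivAlong (u := fun p => u p.swap)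
    isOpen_univ (hu.comp measurable_swap) hx
  obtain ⟨g₂, hg₂, hsnd⟩ := exists_measurable_hasACDerivAlong isOpen_Ioi hu hy
  exact ⟨fun p => (g₁ p.swap, g₂ p), (hg₁.comp measurable_swap).prodMk hg₂, hfst, hsnd⟩

lemma hasGrad_of_contDiff (hf : ContDiff ℝ 1 f) :
    HasGrad f fun p => (partialX f p, partialY f p) where
  measurable := by
    have hfderiv (w : ℝ × ℝ) : Measurable fun p => fderiv ℝ f p w :=
      ((hf.continuous_fderiv (by simp)).clm_apply continuous_const).measurable
    rw [partialX_eq_fderiv (hf.differentiable (by simp)),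
      partialY_eq_fderiv (hf.differentiable (by simp))]
    exact (hfderiv _).prodMk (hfderiv _)
  fst := .of_forall fun y => hasACDeriv_of_contDiff isOpen_univ
    (hf.comp (contDiff_id.prodMk contDiff_const))
  snd := .of_forall fun x => hasACDeriv_of_contDiff isOpen_Ioi
    (hf.comp (contDiff_const.prodMk contDiff_id))

lemma hasGrad_zero : HasGrad (fun _ => 0) fun _ => 0 := by
  simpa [partialX, partialY, ← Prod.zero_eq_mk] using
    hasGrad_of_contDiff (f := fun _ => 0) contDiff_const

end Gradients

section FrameGradient

/-! ### The energy form as a graph form -/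

variable {ρ β : ℝ} {j : ℕ} {g h : ℝ × ℝ → ℝ × ℝ}

/-- The first component `y |x|^β ∂ₓu` of the gradient in the frame `(y |x|^β ∂ₓ, y ∂_y)`, which
is orthonormal for `ρ = 0`. -/
def frameX (β : ℝ) (g : ℝ × ℝ → ℝ × ℝ) (p : ℝ × ℝ) : ℝ := p.2 * |p.1| ^ β * (g p).1

/-- The second component `y ∂_y u` of the gradient in the frame `(y |x|^β ∂ₓ, y ∂_y)`. -/
def frameY (g : ℝ × ℝ → ℝ × ℝ) (p : ℝ × ℝ) : ℝ := p.2 * (g p).2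

lemma measurable_frameX (hg : Measurable g) : Measurable (frameX β g) := by
  unfold frameX; fun_prop

lemma measurable_frameY (hg : Measurable g) : Measurable (frameY g) := by
  unfold frameY; fun_prop

lemma gammaGrad_eq_frame (p : ℝ × ℝ) : gammaGrad ρ β p (g p) (h p) =
    frameX β g p * frameX β h p + ρ * (frameX β g p * frameY h p + frameY g p * frameX β h p)
      + frameY g p * frameY h p := by
  have hsq : |p.1| ^ (2 * β) = |p.1| ^ β * |p.1| ^ β := by
    rw [mul_comm, Real.rpow_mul (abs_nonneg _), Real.rpow_two, sq]
  rw [gammaGrad, hsq, frameX, frameX, frameY, frameY]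
  ring

lemma one_sub_abs_mul_le_gammaGrad (p : ℝ × ℝ) :
    (1 - |ρ|) * (frameX β g p ^ 2 + frameY g p ^ 2) ≤ gammaGrad ρ β p (g p) (g p) := by
  rw [gammaGrad_eq_frame]
  rcases abs_cases ρ with ⟨hρ, _⟩ | ⟨hρ, _⟩ <;> rw [hρ]
  · nlinarith [sq_nonneg (frameX β g p + frameY g p)]
  · nlinarith [sq_nonneg (frameX β g p - frameY g p)]

lemma gammaGrad_self_nonneg (hρ : -1 < ρ ∧ ρ < 1) (p a : ℝ × ℝ) : 0 ≤ gammaGrad ρ β p a a := by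
  refine le_trans ?_ (one_sub_abs_mul_le_gammaGrad (g := fun _ => a) p)
  have : 0 ≤ 1 - |ρ| := sub_nonneg.2 (abs_le.2 ⟨hρ.1.le, hρ.2.le⟩)
  positivity

lemma memLp_of_sq_le_gammaGrad (hρ : -1 < ρ ∧ ρ < 1) {μ : Measure (ℝ × ℝ)} {F : ℝ × ℝ → ℝ}
    (hF : AEStronglyMeasurable F μ) (hle : ∀ p, F p ^ 2 ≤ frameX β g p ^ 2 + frameY g p ^ 2)
    (hg : Integrable (fun p => gammaGrad ρ β p (g p) (g p)) μ) : MemLp F 2 μ := by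
  have hpos : 0 < 1 - |ρ| := sub_pos.2 (abs_lt.2 hρ)
  refine (memLp_two_iff_integrable_sq hF).2 ((hg.const_mul (1 - |ρ|)⁻¹).mono' (hF.pow 2) ?_)
  refine Eventually.of_forall fun p => ?_
  rw [Real.norm_of_nonneg (sq_nonneg _), le_inv_mul_iff₀ hpos]
  exact (mul_le_mul_of_nonneg_left (hle p) hpos.le).trans (one_sub_abs_mul_le_gammaGrad p)

lemma HasGrad.congr_speedMeasure (hρ : -1 < ρ ∧ ρ < 1) {u v : ℝ × ℝ → ℝ} (H : HasGrad u g)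
    (huv : u =ᵐ[speedMeasure ρ β j] v) : HasGrad v g :=
  H.congr (by rwa [EventuallyEq, ← ae_speedMeasure hρ])

lemma HasGrad.gammaAC_ae_eq (hρ : -1 < ρ ∧ ρ < 1) {u v : ℝ × ℝ → ℝ} (hu : HasGrad u g)
    (hv : HasGrad v h) :
    gammaAC ρ β u v =ᵐ[speedMeasure ρ β j] fun p => gammaGrad ρ β p (g p) (h p) := by
  rw [EventuallyEq, ae_speedMeasure hρ]
  filter_upwards [hu.acGradient_ae_eq, hv.acGradient_ae_eq] with p hup hvp
  rw [gammaAC, hup, hvp]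

lemma energy_eq_integral_gammaGrad (hρ : -1 < ρ ∧ ρ < 1) {u v : HilbertL2 ρ β j}
    (hu : HasGrad u g) (hv : HasGrad v h) :
    energy ρ β j u v = (1 / 2) * ∫ p, gammaGrad ρ β p (g p) (h p) ∂speedMeasure ρ β j := by
  rw [energy, integral_congr_ae (hu.gammaAC_ae_eq hρ hv)]

/-- The graph of the gradient `u ↦ (y |x|^β ∂ₓu, y ∂_y u)` as an operator from `H_j` to
`H_j × H_j`. -/
def gradientGraph (hρ : -1 < ρ ∧ ρ < 1) (β : ℝ) (j : ℕ) :
    Submodule ℝ (HilbertL2 ρ β j × HilbertL2 ρ β j × HilbertL2 ρ β j) where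
  carrier := {q | ∃ g, HasGrad q.1 g ∧ q.2.1 =ᵐ[speedMeasure ρ β j] frameX β g ∧
    q.2.2 =ᵐ[speedMeasure ρ β j] frameY g}
  zero_mem' := by
    refine ⟨_, hasGrad_zero.congr_speedMeasure hρ (Lp.coeFn_zero _ _ _).symm, ?_, ?_⟩
    all_goals
      filter_upwards [Lp.coeFn_zero ℝ 2 (speedMeasure ρ β j)] with p hp
      simpa [frameX, frameY] using hp
  add_mem' := by
    rintro q r ⟨g, hg, hgx, hgy⟩ ⟨h, hh, hhx, hhy⟩
    refine ⟨_, (hg.add hh).congr_speedMeasure hρ (Lp.coeFn_add q.1 r.1).symm, ?_, ?_⟩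
    · filter_upwards [hgx, hhx, Lp.coeFn_add q.2.1 r.2.1] with p hgp hhp hp
      refine hp.trans ?_
      rw [Pi.add_apply, hgp, hhp]
      simp only [frameX, Prod.fst_add, mul_add]
    · filter_upwards [hgy, hhy, Lp.coeFn_add q.2.2 r.2.2] with p hgp hhp hp
      refine hp.trans ?_
      rw [Pi.add_apply, hgp, hhp]
      simp only [frameY, Prod.snd_add, mul_add]
  smul_mem' := by
    rintro c q ⟨g, hg, hgx, hgy⟩
    refine ⟨_, (hg.const_mul c).congr_speedMeasure hρ (Lp.coeFn_smul c q.1).symm, ?_, ?_⟩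
    · filter_upwards [hgx, Lp.coeFn_smul c q.2.1] with p hgp hp
      refine hp.trans ?_
      rw [Pi.smul_apply, hgp]
      simp only [frameX, Prod.smul_fst, smul_eq_mul, mul_left_comm]
    · filter_upwards [hgy, Lp.coeFn_smul c q.2.2] with p hgp hp
      refine hp.trans ?_
      rw [Pi.smul_apply, hgp]
      simp only [frameY, Prod.smul_snd, smul_eq_mul, mul_left_comm]

lemma HasGrad.mem_gradientGraph (hρ : -1 < ρ ∧ ρ < 1) {u : HilbertL2 ρ β j} (hu : HasGrad u g)
    (hx : MemLp (frameX β g) 2 (speedMeasure ρ β j))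
    (hy : MemLp (frameY g) 2 (speedMeasure ρ β j)) :
    (u, hx.toLp _, hy.toLp _) ∈ gradientGraph hρ β j :=
  ⟨g, hu, hx.coeFn_toLp, hy.coeFn_toLp⟩

lemma integrable_mul_of_ae_eq {a b : HilbertL2 ρ β j} {F F' : ℝ × ℝ → ℝ}
    (ha : a =ᵐ[speedMeasure ρ β j] F) (hb : b =ᵐ[speedMeasure ρ β j] F') :
    Integrable (fun p => F p * F' p) (speedMeasure ρ β j) :=
  ((Lp.memLp a).ae_eq ha).integrable_mul ((Lp.memLp b).ae_eq hb)

lemma inner_eq_integral {a b : HilbertL2 ρ β j} {F F' : ℝ × ℝ → ℝ}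
    (ha : a =ᵐ[speedMeasure ρ β j] F) (hb : b =ᵐ[speedMeasure ρ β j] F') :
    inner ℝ a b = ∫ p, F p * F' p ∂speedMeasure ρ β j := by
  rw [L2.inner_def]
  refine integral_congr_ae ?_
  filter_upwards [ha, hb] with p hap hbp
  rw [hap, hbp, Real.inner_apply]

section GammaGrad

variable {k l : HilbertL2 ρ β j × HilbertL2 ρ β j}

lemma integrable_gammaGrad
    (hkx : k.1 =ᵐ[speedMeasure ρ β j] frameX β g) (hky : k.2 =ᵐ[speedMeasure ρ β j] frameY g)
    (hlx : l.1 =ᵐ[speedMeasure ρ β j] frameX β h) (hly : l.2 =ᵐ[speedMeasure ρ β j] frameY h) :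
    Integrable (fun p => gammaGrad ρ β p (g p) (h p)) (speedMeasure ρ β j) := by
  simp_rw [gammaGrad_eq_frame]
  exact ((integrable_mul_of_ae_eq hkx hlx).add (((integrable_mul_of_ae_eq hkx hly).add
    (integrable_mul_of_ae_eq hky hlx)).const_mul ρ)).add (integrable_mul_of_ae_eq hky hly)

lemma integral_gammaGrad
    (hkx : k.1 =ᵐ[speedMeasure ρ β j] frameX β g) (hky : k.2 =ᵐ[speedMeasure ρ β j] frameY g)
    (hlx : l.1 =ᵐ[speedMeasure ρ β j] frameX β h) (hly : l.2 =ᵐ[speedMeasure ρ β j] frameY h) :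
    ∫ p, gammaGrad ρ β p (g p) (h p) ∂speedMeasure ρ β j =
      inner ℝ k.1 l.1 + ρ * (inner ℝ k.1 l.2 + inner ℝ k.2 l.1) + inner ℝ k.2 l.2 := by
  have hxx := integrable_mul_of_ae_eq hkx hlx
  have hxy := integrable_mul_of_ae_eq hkx hly
  have hyx := integrable_mul_of_ae_eq hky hlx
  have hyy := integrable_mul_of_ae_eq hky hly
  have hmixed : Integrable (fun p => ρ * (frameX β g p * frameY h p + frameY g p * frameX β h p))
      (speedMeasure ρ β j) := (hxy.add hyx).const_mul ρ
  simp_rw [gammaGrad_eq_frame]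
  rw [inner_eq_integral hkx hlx, inner_eq_integral hkx hly, inner_eq_integral hky hlx,
    inner_eq_integral hky hly, integral_add (by exact hxx.add hmixed) hyy,
    integral_add hxx hmixed, integral_const_mul, integral_add hxy hyx]

end GammaGrad

/-- The bilinear form of the constant matrix `½ (1 ρ; ρ 1)` on `V × V`. -/
def frameForm (V : Type*) [NormedAddCommGroup V] [InnerProductSpace ℝ V] (ρ : ℝ) :
    LinearMap.BilinForm ℝ (V × V) :=
  (1 / 2 : ℝ) • ((innerₗ V).compl₁₂ (.fst ℝ V V) (.fst ℝ V V)
    + ρ • ((innerₗ V).compl₁₂ (.fst ℝ V V) (.snd ℝ V V)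
      + (innerₗ V).compl₁₂ (.snd ℝ V V) (.fst ℝ V V))
    + (innerₗ V).compl₁₂ (.snd ℝ V V) (.snd ℝ V V))

section FrameForm

variable {V : Type*} [NormedAddCommGroup V] [InnerProductSpace ℝ V]

lemma frameForm_apply (k l : V × V) : frameForm V ρ k l =
    1 / 2 * (inner ℝ k.1 l.1 + ρ * (inner ℝ k.1 l.2 + inner ℝ k.2 l.1) + inner ℝ k.2 l.2) := by
  simp only [frameForm, LinearMap.smul_apply, LinearMap.add_apply, LinearMap.compl₁₂_apply,
    LinearMap.fst_apply, LinearMap.snd_apply, innerₗ_apply_apply, smul_eq_mul]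

lemma frameForm_comm (k l : V × V) : frameForm V ρ k l = frameForm V ρ l k := by
  simp only [frameForm_apply, real_inner_comm, add_comm]

lemma frameForm_self (k : V × V) : frameForm V ρ k k =
    1 / 2 * (‖k.1‖ ^ 2 + 2 * ρ * inner ℝ k.1 k.2 + ‖k.2‖ ^ 2) := by
  rw [frameForm_apply, real_inner_self_eq_norm_sq, real_inner_self_eq_norm_sq,
    real_inner_comm k.1 k.2]
  ring

lemma mul_norm_sq_le_frameForm_self (hρ : -1 < ρ ∧ ρ < 1) (k : V × V) :
    (1 - |ρ|) / 2 * ‖k‖ ^ 2 ≤ frameForm V ρ k k := by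
  have hnorm : ‖k‖ ^ 2 ≤ ‖k.1‖ ^ 2 + ‖k.2‖ ^ 2 := by
    rcases max_choice ‖k.1‖ ‖k.2‖ with hk | hk <;> rw [Prod.norm_def, hk]
    · exact le_add_of_nonneg_right (sq_nonneg _)
    · exact le_add_of_nonneg_left (sq_nonneg _)
  have hinner : |ρ * inner ℝ k.1 k.2| ≤ |ρ| * (‖k.1‖ * ‖k.2‖) := by
    rw [abs_mul]
    exact mul_le_mul_of_nonneg_left (abs_real_inner_le_norm _ _) (abs_nonneg ρ)
  have hamgm : |ρ| * (2 * ‖k.1‖ * ‖k.2‖) ≤ |ρ| * (‖k.1‖ ^ 2 + ‖k.2‖ ^ 2) :=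
    mul_le_mul_of_nonneg_left (two_mul_le_add_sq _ _) (abs_nonneg ρ)
  have hmono : (1 - |ρ|) * ‖k‖ ^ 2 ≤ (1 - |ρ|) * (‖k.1‖ ^ 2 + ‖k.2‖ ^ 2) :=
    mul_le_mul_of_nonneg_left hnorm (sub_nonneg.2 (abs_le.2 ⟨hρ.1.le, hρ.2.le⟩))
  rw [frameForm_self]
  linarith [neg_abs_le (ρ * inner ℝ k.1 k.2)]

lemma frameForm_self_le (hρ : -1 < ρ ∧ ρ < 1) (k : V × V) :
    frameForm V ρ k k ≤ 2 * ‖k‖ ^ 2 := by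
  have hfst : ‖k.1‖ ^ 2 ≤ ‖k‖ ^ 2 := pow_le_pow_left₀ (norm_nonneg _) (norm_fst_le k) 2
  have hsnd : ‖k.2‖ ^ 2 ≤ ‖k‖ ^ 2 := pow_le_pow_left₀ (norm_nonneg _) (norm_snd_le k) 2
  have hinner : ρ * inner ℝ k.1 k.2 ≤ ‖k.1‖ * ‖k.2‖ := calc
    _ ≤ |ρ| * |inner ℝ k.1 k.2| := (le_abs_self _).trans_eq (abs_mul _ _)
    _ ≤ 1 * (‖k.1‖ * ‖k.2‖) := mul_le_mul (abs_le.2 ⟨hρ.1.le, hρ.2.le⟩)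
      (abs_real_inner_le_norm _ _) (abs_nonneg _) zero_le_one
    _ = ‖k.1‖ * ‖k.2‖ := one_mul _
  rw [frameForm_self]
  linarith [two_mul_le_add_sq ‖k.1‖ ‖k.2‖]

end FrameForm

lemma isGraphForm_energy (hρ : -1 < ρ ∧ ρ < 1) : IsGraphForm (gradientGraph hρ β j)
    (frameForm (HilbertL2 ρ β j) ρ) (energyDomain ρ β j) (energy ρ β j) where
  mem_iff {u} := by
    constructor
    · rintro ⟨hx, hy, hint⟩
      obtain ⟨g, hg⟩ := exists_hasGrad (Lp.stronglyMeasurable u).measurable hx hy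
      have hint' := hint.congr (hg.gammaAC_ae_eq hρ hg)
      exact ⟨_, hg.mem_gradientGraph hρ
        (memLp_of_sq_le_gammaGrad hρ (measurable_frameX hg.measurable).aestronglyMeasurable
          (fun p => le_add_of_nonneg_right (sq_nonneg _)) hint')
        (memLp_of_sq_le_gammaGrad hρ (measurable_frameY hg.measurable).aestronglyMeasurable
          (fun p => le_add_of_nonneg_left (sq_nonneg _)) hint')⟩
    · rintro ⟨k, g, hg, hx, hy⟩
      exact ⟨hg.fst.ae_exists_isACVersion, hg.snd.ae_exists_isACVersion,
        (integrable_gammaGrad hx hy hx hy).congr (hg.gammaAC_ae_eq hρ hg).symm⟩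
  eq_apply := by
    rintro u v k l ⟨g, hg, hgx, hgy⟩ ⟨h, hh, hhx, hhy⟩
    rw [energy_eq_integral_gammaGrad hρ hg hh, integral_gammaGrad hgx hgy hhx hhy,
      frameForm_apply]

end FrameGradient

section Closedness

/-! ### Closedness of the gradient -/

section Lp

variable {α : Type*} [MeasurableSpace α] {μ : Measure α}

lemma lintegral_enorm_sub_sq_eq_edist_sq (f l : Lp ℝ 2 μ) :
    ∫⁻ p, ‖f p - l p‖ₑ ^ 2 ∂μ = edist f l ^ 2 := by
  rw [Lp.edist_def]
  simpa using (eLpNorm_nnreal_pow_eq_lintegral (μ := μ) (f := ⇑f - ⇑l) (p := 2) two_ne_zero).symm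

lemma tsum_lintegral_enorm_sub_sq_ne_top {f : ℕ → Lp ℝ 2 μ} {l : Lp ℝ 2 μ}
    (hf : ∀ n, edist (f n) l ≤ 2⁻¹ ^ n) : ∑' n, ∫⁻ p, ‖f n p - l p‖ₑ ^ 2 ∂μ ≠ ⊤ := by
  have hle (n : ℕ) : ∫⁻ p, ‖f n p - l p‖ₑ ^ 2 ∂μ ≤ 2⁻¹ ^ n := calc
    _ = edist (f n) l ^ 2 := lintegral_enorm_sub_sq_eq_edist_sq _ _
    _ ≤ (2⁻¹ ^ n) ^ 2 := pow_le_pow_left' (hf n) 2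
    _ ≤ 2⁻¹ ^ n := pow_le_of_le_one zero_le (pow_le_one₀ zero_le (by simp)) two_ne_zero
  refine ne_top_of_le_ne_top ?_ (ENNReal.tsum_le_tsum hle)
  rw [ENNReal.tsum_geometric]
  simp

lemma ae_tendsto_of_tsum_lintegral_ne_top {u : ℕ → α → ℝ} {v : α → ℝ}
    (hu : ∀ n, Measurable (u n)) (hv : Measurable v)
    (hsum : ∑' n, ∫⁻ p, ‖u n p - v p‖ₑ ^ 2 ∂μ ≠ ⊤) :
    ∀ᵐ p ∂μ, Tendsto (fun n => u n p) atTop (𝓝 (v p)) := by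
  have hmeas (n : ℕ) : Measurable fun p => ‖u n p - v p‖ₑ ^ 2 := ((hu n).sub hv).enorm.pow_const 2
  rw [← lintegral_tsum fun n => (hmeas n).aemeasurable] at hsum
  filter_upwards [ae_lt_top (.tsum hmeas) hsum] with p hp
  have hsq := ENNReal.tendsto_atTop_zero_of_tsum_ne_top hp.ne
  have hsqrt := ((ENNReal.continuous_rpow_const (y := 1 / 2)).tendsto 0).comp hsq
  rw [ENNReal.zero_rpow_of_pos (by norm_num)] at hsqrt
  refine tendsto_iff_edist_tendsto_0.2 (hsqrt.congr fun n => ?_)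
  rw [Function.comp_apply, edist_eq_enorm_sub, ← ENNReal.rpow_natCast, ← ENNReal.rpow_mul]
  norm_num

end Lp

lemma locallyIntegrable_abs_rpow {s : ℝ} (hs : -1 < s) :
    LocallyIntegrable fun x : ℝ => |x| ^ s := by
  refine locallyIntegrable_of_norm_le_rpow (C := 1) (α := -s) (by simp) (by simp; linarith)
    (Eventually.of_forall fun x => ?_) (measurable_norm.pow_const s).aestronglyMeasurable
  rw [Real.norm_of_nonneg (by positivity), neg_neg, one_mul, Real.norm_eq_abs]

variable {ρ β : ℝ} {j : ℕ} {u : ℝ × ℝ → ℝ} {g : ℝ × ℝ → ℝ × ℝ}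
  {un : ℕ → ℝ × ℝ → ℝ} {gn : ℕ → ℝ × ℝ → ℝ × ℝ}

lemma inv_snd_sq_mul_speedDensity {x y : ℝ} (hy : y ≠ 0) :
    (y ^ 2 * speedDensity ρ β j (x, y))⁻¹ = √(1 - ρ ^ 2) * |x| ^ (β * (1 + j)) := by
  rw [speedDensity, mul_one_div, inv_div, mul_div_cancel_right₀ _ (pow_ne_zero 2 hy)]

lemma inv_snd_mul_abs_rpow_sq_mul_speedDensity {x y : ℝ} (hx : x ≠ 0) (hy : y ≠ 0) :
    ((y * |x| ^ β) ^ 2 * speedDensity ρ β j (x, y))⁻¹ =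
      √(1 - ρ ^ 2) * |x| ^ (β * (1 + j) - 2 * β) := by
  have hx' := abs_pos.2 hx
  rw [Real.rpow_sub hx', mul_comm 2 β, Real.rpow_mul (abs_nonneg x) β 2, Real.rpow_two,
    ← mul_div_assoc, ← inv_snd_sq_mul_speedDensity hy]
  field_simp

lemma hasACDerivAlong_snd_of_tsum (hρ : -1 < ρ ∧ ρ < 1) (H : ∀ n, HasGrad (un n) (gn n))
    (hg : Measurable g)
    (hu : ∀ᵐ p ∂volume.restrict halfPlane, Tendsto (fun n => un n p) atTop (𝓝 (u p)))
    (hsum : ∑' n, ∫⁻ p, ‖frameY (gn n) p - frameY g p‖ₑ ^ 2 ∂speedMeasure ρ β j ≠ ⊤) :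
    HasACDerivAlong volume (Ioi 0) u fun p => (g p).2 := by
  refine HasACDerivAlong.of_tsum isOpen_Ioi (fun n => (H n).snd) hg.snd
    (fun n => (H n).measurable.snd) (volume_restrict_halfPlane ▸ hu) measurable_snd
    (measurable_speedDensity (ρ := ρ) (β := β) (j := j)) ?_ (.of_forall fun x a b hab => ?_) ?_
  · rw [← volume_restrict_halfPlane]
    filter_upwards [ae_fst_ne_zero, ae_restrict_mem measurableSet_halfPlane] with p hx hy
    have hy' : p.2 ≠ 0 := ne_of_gt hy
    have := speedDensity_pos (β := β) (j := j) hρ hx hy'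
    positivity
  · refine IntervalIntegrable.congr (fun t ht => ?_)
      (intervalIntegrable_const (c := √(1 - ρ ^ 2) * |x| ^ (β * (1 + j))))
    exact (inv_snd_sq_mul_speedDensity (ne_of_gt (hab (uIoc_subset_uIcc ht)))).symm
  · refine ne_of_eq_of_ne (tsum_congr fun n => ?_) hsum
    have hmeas : Measurable fun p => ‖frameY (gn n) p - frameY g p‖ₑ ^ 2 :=
      ((measurable_frameY (H n).measurable).sub (measurable_frameY hg)).enorm.pow_const 2
    rw [lintegral_speedMeasure hmeas, volume_restrict_halfPlane]
    rfl

lemma hasACDerivAlong_fst_of_tsum (hρ : -1 < ρ ∧ ρ < 1) (hβ : -1 < β * (1 + j) - 2 * β)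
    (H : ∀ n, HasGrad (un n) (gn n)) (hg : Measurable g)
    (hu : ∀ᵐ p ∂volume.restrict halfPlane, Tendsto (fun n => un n p) atTop (𝓝 (u p)))
    (hsum : ∑' n, ∫⁻ p, ‖frameX β (gn n) p - frameX β g p‖ₑ ^ 2 ∂speedMeasure ρ β j ≠ ⊤) :
    HasACDerivAlong (volume.restrict (Ioi 0)) univ (fun p => u p.swap) fun p => (g p.swap).1 := by
  have hswap := measurePreserving_swap_halfPlane.quasiMeasurePreserving
  refine HasACDerivAlong.of_tsum isOpen_univ (fun n => (H n).fst) (hg.comp measurable_swap).fst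
    (fun n => ((H n).measurable.comp measurable_swap).fst) (hswap.ae hu)
    (c := fun p => p.1 * |p.2| ^ β) (by fun_prop)
    ((measurable_speedDensity (ρ := ρ) (β := β) (j := j)).comp measurable_swap)
    (hswap.ae (p := fun p => 0 < (p.2 * |p.1| ^ β) ^ 2 * speedDensity ρ β j p) ?_) ?_ ?_
  · filter_upwards [ae_fst_ne_zero, ae_restrict_mem measurableSet_halfPlane] with p hx hy
    have hy' : p.2 ≠ 0 := ne_of_gt hy
    have := speedDensity_pos (β := β) (j := j) hρ hx hy'
    positivity
  · filter_upwards [ae_restrict_mem measurableSet_Ioi] with y hy a b _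
    have hint := ((locallyIntegrable_abs_rpow hβ).integrableOn_isCompact
      (isCompact_uIcc (a := a) (b := b))).intervalIntegrable
    refine (hint.const_mul √(1 - ρ ^ 2)).congr_ae ?_
    filter_upwards [ae_restrict_of_ae (Measure.ae_ne volume 0)] with x hx
    exact (inv_snd_mul_abs_rpow_sq_mul_speedDensity hx (ne_of_gt hy)).symm
  · refine ne_of_eq_of_ne (tsum_congr fun n => ?_) hsum
    have hmeas : Measurable fun p => ‖frameX β (gn n) p - frameX β g p‖ₑ ^ 2 :=
      ((measurable_frameX (H n).measurable).sub (measurable_frameX hg)).enorm.pow_const 2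
    rw [lintegral_speedMeasure hmeas,
      ← measurePreserving_swap_halfPlane.lintegral_comp_emb
        MeasurableEquiv.prodComm.measurableEmbedding]
    rfl

/-- The gradient with the frame components `kx` and `ky`. -/
def gradOfFrame (β : ℝ) (kx ky : ℝ × ℝ → ℝ) (p : ℝ × ℝ) : ℝ × ℝ :=
  (kx p / (p.2 * |p.1| ^ β), ky p / p.2)

lemma measurable_gradOfFrame {kx ky : ℝ × ℝ → ℝ} (hkx : Measurable kx) (hky : Measurable ky) :
    Measurable (gradOfFrame β kx ky) := by
  unfold gradOfFrame; fun_prop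

lemma frameX_gradOfFrame_ae_eq (hρ : -1 < ρ ∧ ρ < 1) (kx ky : ℝ × ℝ → ℝ) :
    frameX β (gradOfFrame β kx ky) =ᵐ[speedMeasure ρ β j] kx := by
  rw [EventuallyEq, ae_speedMeasure hρ]
  filter_upwards [ae_fst_ne_zero, ae_restrict_mem measurableSet_halfPlane] with p hx hy
  have hy' : p.2 ≠ 0 := ne_of_gt hy
  exact mul_div_cancel₀ _ (by positivity)

lemma frameY_gradOfFrame_ae_eq (hρ : -1 < ρ ∧ ρ < 1) (kx ky : ℝ × ℝ → ℝ) :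
    frameY (gradOfFrame β kx ky) =ᵐ[speedMeasure ρ β j] ky := by
  rw [EventuallyEq, ae_speedMeasure hρ]
  filter_upwards [ae_restrict_mem measurableSet_halfPlane] with p hy
  exact mul_div_cancel₀ _ (ne_of_gt hy)

lemma isClosed_gradientGraph (hρ : -1 < ρ ∧ ρ < 1) (hβ : -1 < β * (1 + j) - 2 * β) :
    IsClosed (gradientGraph hρ β j :
      Set (HilbertL2 ρ β j × HilbertL2 ρ β j × HilbertL2 ρ β j)) := by
  refine isClosed_of_closure_subset fun ⟨u, kx, ky⟩ hq => ?_
  have happrox (n : ℕ) := EMetric.mem_closure_iff.1 hq (2⁻¹ ^ n) (ENNReal.pow_pos (by simp) n)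
  choose q hqG hqdist using happrox
  choose g hg hgx hgy using hqG
  have hdist (n : ℕ) : edist (q n).1 u ≤ 2⁻¹ ^ n ∧ edist (q n).2.1 kx ≤ 2⁻¹ ^ n ∧
      edist (q n).2.2 ky ≤ 2⁻¹ ^ n := by
    have hle := (hqdist n).le
    rw [edist_comm, Prod.edist_eq, Prod.edist_eq] at hle
    simpa only [max_le_iff] using hle
  have hu : ∀ᵐ p ∂volume.restrict halfPlane, Tendsto (fun n => (q n).1 p) atTop (𝓝 (u p)) := by
    rw [← ae_speedMeasure (β := β) (j := j) hρ]
    exact ae_tendsto_of_tsum_lintegral_ne_top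
      (fun n => (Lp.stronglyMeasurable _).measurable) (Lp.stronglyMeasurable u).measurable
      (tsum_lintegral_enorm_sub_sq_ne_top fun n => (hdist n).1)
  have hgrad : Measurable (gradOfFrame β kx ky) := measurable_gradOfFrame
    (Lp.stronglyMeasurable kx).measurable (Lp.stronglyMeasurable ky).measurable
  have hkx := frameX_gradOfFrame_ae_eq (β := β) (j := j) hρ kx ky
  have hky := frameY_gradOfFrame_ae_eq (β := β) (j := j) hρ kx ky
  refine ⟨gradOfFrame β kx ky, ⟨hgrad, hasACDerivAlong_fst_of_tsum hρ hβ hg hgrad hu ?_,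
    hasACDerivAlong_snd_of_tsum (β := β) (j := j) hρ hg hgrad hu ?_⟩, hkx.symm, hky.symm⟩
  · refine ne_of_eq_of_ne (tsum_congr fun n => lintegral_congr_ae ?_)
      (tsum_lintegral_enorm_sub_sq_ne_top fun n => (hdist n).2.1)
    filter_upwards [hgx n, hkx] with p hp hp'
    rw [hp, hp']
  · refine ne_of_eq_of_ne (tsum_congr fun n => lintegral_congr_ae ?_)
      (tsum_lintegral_enorm_sub_sq_ne_top fun n => (hdist n).2.2)
    filter_upwards [hgy n, hky] with p hp hp'
    rw [hp, hp']

end Closedness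

section Markov

/-! ### The Dirichlet form -/

variable {ρ β : ℝ} {j : ℕ} {u : ℝ × ℝ → ℝ} {g : ℝ × ℝ → ℝ × ℝ}

/-- The gradient `1_{0 < u < 1} g` of `u⁺ ∧ 1`, for a gradient `g` of `u`. -/
def clampGrad (u : ℝ × ℝ → ℝ) (g : ℝ × ℝ → ℝ × ℝ) (p : ℝ × ℝ) : ℝ × ℝ :=
  (Ioo (0 : ℝ) 1).indicator (1 : ℝ → ℝ) (u p) • g p

lemma clampGrad_eq_self_or_zero (p : ℝ × ℝ) : clampGrad u g p = g p ∨ clampGrad u g p = 0 := by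
  by_cases hp : u p ∈ Ioo (0 : ℝ) 1 <;> simp [clampGrad, hp]

lemma gammaGrad_clampGrad_le (hρ : -1 < ρ ∧ ρ < 1) (p : ℝ × ℝ) :
    gammaGrad ρ β p (clampGrad u g p) (clampGrad u g p) ≤ gammaGrad ρ β p (g p) (g p) := by
  rcases clampGrad_eq_self_or_zero (u := u) (g := g) p with hp | hp <;> rw [hp]
  exact le_trans (by simp [gammaGrad]) (gammaGrad_self_nonneg hρ p (g p))

lemma memLp_frameX_clampGrad {μ : Measure (ℝ × ℝ)} (hg : Measurable (clampGrad u g))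
    (hx : MemLp (frameX β g) 2 μ) : MemLp (frameX β (clampGrad u g)) 2 μ := by
  refine hx.mono (measurable_frameX hg).aestronglyMeasurable (.of_forall fun p => ?_)
  rcases clampGrad_eq_self_or_zero (u := u) (g := g) p with hp | hp
  · rw [frameX, frameX, hp]
  · simp only [frameX, hp, Prod.fst_zero, mul_zero, norm_zero, norm_nonneg]

lemma memLp_frameY_clampGrad {μ : Measure (ℝ × ℝ)} (hg : Measurable (clampGrad u g))
    (hy : MemLp (frameY g) 2 μ) : MemLp (frameY (clampGrad u g)) 2 μ := by
  refine hy.mono (measurable_frameY hg).aestronglyMeasurable (.of_forall fun p => ?_)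
  rcases clampGrad_eq_self_or_zero (u := u) (g := g) p with hp | hp
  · rw [frameY, frameY, hp]
  · simp only [frameY, hp, Prod.snd_zero, mul_zero, norm_zero, norm_nonneg]

lemma memLp_unitClamp_comp {α : Type*} [MeasurableSpace α] {μ : Measure α} {v : α → ℝ}
    (hv : MemLp v 2 μ) : MemLp (fun p => unitClamp (v p)) 2 μ := by
  refine hv.mono (lipschitzWith_unitClamp.continuous.comp_aestronglyMeasurable hv.1)
    (.of_forall fun p => ?_)
  simpa [unitClamp_of_nonpos] using lipschitzWith_unitClamp.dist_le_mul (v p) 0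

lemma exists_unitClamp_mem_energyDomain (hρ : -1 < ρ ∧ ρ < 1) {u : HilbertL2 ρ β j}
    (hu : u ∈ energyDomain ρ β j) :
    ∃ w ∈ energyDomain ρ β j, (w =ᵐ[speedMeasure ρ β j] fun p => unitClamp (u p)) ∧
      energy ρ β j w w ≤ energy ρ β j u u := by
  obtain ⟨k, g, hg, hx, hy⟩ := (isGraphForm_energy hρ).mem_iff.1 hu
  have hclamp := memLp_unitClamp_comp (Lp.memLp u)
  have hgrad : HasGrad (hclamp.toLp _) (clampGrad u g) :=
    (hg.unitClamp_comp (Lp.stronglyMeasurable u).measurable).congr_speedMeasure hρ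
      hclamp.coeFn_toLp.symm
  have hx' := memLp_frameX_clampGrad hgrad.measurable ((Lp.memLp k.1).ae_eq hx)
  have hy' := memLp_frameY_clampGrad hgrad.measurable ((Lp.memLp k.2).ae_eq hy)
  have hint : Integrable (fun p => gammaGrad ρ β p (clampGrad u g p) (clampGrad u g p))
      (speedMeasure ρ β j) :=
    integrable_gammaGrad (k := (hx'.toLp _, hy'.toLp _)) (l := (hx'.toLp _, hy'.toLp _))
      hx'.coeFn_toLp hy'.coeFn_toLp hx'.coeFn_toLp hy'.coeFn_toLp
  refine ⟨hclamp.toLp _, (isGraphForm_energy hρ).mem_iff.2 ⟨_, hgrad.mem_gradientGraph hρ hx' hy'⟩,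
    hclamp.coeFn_toLp, ?_⟩
  rw [energy_eq_integral_gammaGrad hρ hgrad hgrad, energy_eq_integral_gammaGrad hρ hg hg]
  exact mul_le_mul_of_nonneg_left (integral_mono hint (integrable_gammaGrad hx hy hx hy)
    fun p => gammaGrad_clampGrad_le hρ p) (by norm_num)

lemma isDirichletForm_energyDomain (hρ : -1 < ρ ∧ ρ < 1) (hβ : -1 < β * (1 + j) - 2 * β)
    (hdense : Dense (energyDomain ρ β j)) :
    IsDirichletForm (energyDomain ρ β j) (energy ρ β j) where
  toIsClosedForm := (isGraphForm_energy hρ).isClosedForm hdense (isClosed_gradientGraph hρ hβ)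
    frameForm_comm (half_pos (sub_pos.2 (abs_lt.2 hρ))) (mul_norm_sq_le_frameForm_self hρ)
    (frameForm_self_le hρ)
  markov _ hu := exists_unitClamp_mem_energyDomain hρ hu

end Markov

section TestFunctions

/-! ### Test functions -/

variable {U : Set (ℝ × ℝ)} {f f' v : ℝ × ℝ → ℝ}

namespace IsTest

lemma differentiable (hf : IsTest U f) : Differentiable ℝ f := hf.1.differentiable (by simp)

lemma fderiv_apply (hf : IsTest U f) (w : ℝ × ℝ) : IsTest U fun p => fderiv ℝ f p w := by
  have hsub := tsupport_fderiv_apply_subset (f := f) ℝ w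
  exact ⟨(hf.1.fderiv_right (m := ∞) (by simp)).clm_apply contDiff_const,
    hf.2.1.of_isClosed_subset (isClosed_tsupport _) hsub, hsub.trans hf.2.2⟩

protected lemma partialX (hf : IsTest U f) : IsTest U (partialX f) :=
  partialX_eq_fderiv hf.differentiable ▸ hf.fderiv_apply _

protected lemma partialY (hf : IsTest U f) : IsTest U (partialY f) :=
  partialY_eq_fderiv hf.differentiable ▸ hf.fderiv_apply _

lemma partialX_partialY (hf : IsTest U f) :
    partialX (partialY f) = partialY (partialX f) := by
  rw [partialX_eq_fderiv hf.partialY.differentiable, partialY_eq_fderiv hf.partialX.differentiable,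
    partialX_eq_fderiv hf.differentiable, partialY_eq_fderiv hf.differentiable]
  funext p
  have hdiff : DifferentiableAt ℝ (fderiv ℝ f) p :=
    (hf.1.fderiv_right (m := ∞) (by simp)).differentiable (by simp) p
  have hsymm : IsSymmSndFDerivAt ℝ f p := hf.1.contDiffAt.isSymmSndFDerivAt <| by
    rw [minSmoothness_of_isRCLikeNormedField]
    exact WithTop.coe_le_coe.2 (le_top (a := (2 : ℕ∞)))
  rw [fderiv_clm_apply hdiff (differentiableAt_const _),
    fderiv_clm_apply hdiff (differentiableAt_const _)]
  simpa using hsymm.eq (1, 0) (0, 1)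

lemma eq_zero (hf : IsTest U f) {p : ℝ × ℝ} (hp : p ∉ U) : f p = 0 :=
  image_eq_zero_of_notMem_tsupport fun h => hp (hf.2.2 h)

protected lemma zero : IsTest U fun _ => 0 :=
  ⟨contDiff_const, HasCompactSupport.zero, by simp [tsupport]⟩

protected lemma add (hf : IsTest U f) (hf' : IsTest U f') : IsTest U fun p => f p + f' p :=
  ⟨hf.1.add hf'.1, hf.2.1.add hf'.2.1,
    (tsupport_add f f').trans (union_subset hf.2.2 hf'.2.2)⟩

protected lemma const_mul (c : ℝ) (hf : IsTest U f) : IsTest U fun p => c * f p :=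
  ⟨contDiff_const.mul hf.1, hf.2.1.mul_left,
    (tsupport_mul_subset_right (f := fun _ => c)).trans hf.2.2⟩

lemma mul_of_contDiffOn (hf : IsTest U f) (hU : IsOpen U) {c : ℝ × ℝ → ℝ}
    (hc : ContDiffOn ℝ ∞ c U) : IsTest U fun p => c p * f p := by
  refine ⟨contDiff_iff_contDiffAt.2 fun p => ?_, hf.2.1.mul_left,
    tsupport_mul_subset_right.trans hf.2.2⟩
  by_cases hp : p ∈ tsupport f
  · exact (hc.contDiffAt (hU.mem_nhds (hf.2.2 hp))).mul hf.1.contDiffAt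
  · refine (contDiffAt_const (c := (0 : ℝ))).congr_of_eventuallyEq ?_
    filter_upwards [notMem_tsupport_iff_eventuallyEq.1 hp] with q hq
    rw [hq, Pi.zero_apply, mul_zero]

lemma rpow_mul (a : ℝ) (hf : IsTest quadrant f) : IsTest quadrant fun p => p.1 ^ a * f p :=
  hf.mul_of_contDiffOn isOpen_quadrant fun _ hp =>
    (contDiffAt_fst.rpow_const_of_ne (ne_of_gt hp.1)).contDiffWithinAt

lemma integrable_mul (hf : IsTest U f) (hv : LocallyIntegrableOn v U) :
    Integrable fun p => f p * v p := by
  have hon : IntegrableOn (fun p => f p * v p) (tsupport f) :=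
    (hv.integrableOn_compact_subset hf.2.2 hf.2.1).continuousOn_mul
      hf.1.continuous.continuousOn hf.2.1
  refine (integrableOn_iff_integrable_of_support_subset ?_).1 hon
  exact (Function.support_mul_subset_left f v).trans (subset_tsupport f)

end IsTest

end TestFunctions

section TestFunctionsInDomain

/-! ### Test functions in the domain of the energy form -/

variable {ρ β : ℝ} {j : ℕ} {U : Set (ℝ × ℝ)} {f f₁ f₂ v : ℝ × ℝ → ℝ}

lemma locallyIntegrable_abs_fst_rpow {s : ℝ} (hs : -1 < s) :
    LocallyIntegrable fun p : ℝ × ℝ => |p.1| ^ s := by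
  refine locallyIntegrable_iff.2 fun K hK => ?_
  have hprod :
      IntegrableOn (fun p : ℝ × ℝ => |p.1| ^ s) ((Prod.fst '' K) ×ˢ (Prod.snd '' K)) := by
    have : IsFiniteMeasure ((volume : Measure ℝ).restrict (Prod.snd '' K)) :=
      isFiniteMeasure_restrict.2 (hK.image continuous_snd).measure_ne_top
    rw [IntegrableOn, Measure.volume_eq_prod, ← Measure.prod_restrict]
    exact ((locallyIntegrable_abs_rpow hs).integrableOn_isCompact
      (hK.image continuous_fst)).comp_fst _
  exact hprod.mono_set fun p hp => ⟨mem_image_of_mem _ hp, mem_image_of_mem _ hp⟩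

lemma speedDensity_eq_mul_abs_rpow (p : ℝ × ℝ) :
    speedDensity ρ β j p = (√(1 - ρ ^ 2))⁻¹ * (p.2 ^ 2)⁻¹ * |p.1| ^ (-(β * (1 + j))) := by
  rw [speedDensity, Real.rpow_neg (abs_nonneg _), one_div, mul_inv, mul_inv]
  ring

lemma speedDensity_mul_sq_eq_mul_abs_rpow {p : ℝ × ℝ} (hx : p.1 ≠ 0) (hy : p.2 ≠ 0) :
    speedDensity ρ β j p * (p.2 * |p.1| ^ β) ^ 2 =
      (√(1 - ρ ^ 2))⁻¹ * |p.1| ^ (2 * β - β * (1 + j)) := by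
  rw [speedDensity_eq_mul_abs_rpow, sub_eq_add_neg (2 * β), Real.rpow_add (abs_pos.2 hx),
    mul_comm 2 β, Real.rpow_mul (abs_nonneg _) β 2, Real.rpow_two]
  field_simp

lemma locallyIntegrableOn_speedDensity_halfPlane (hβ : β * (1 + j) < 1) :
    LocallyIntegrableOn (speedDensity ρ β j) halfPlane := by
  have hcont : ContinuousOn (fun p : ℝ × ℝ => (√(1 - ρ ^ 2))⁻¹ * (p.2 ^ 2)⁻¹) halfPlane :=
    continuousOn_const.mul ((continuousOn_snd.pow 2).inv₀ fun p hp => pow_ne_zero 2 (ne_of_gt hp))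
  rw [funext speedDensity_eq_mul_abs_rpow]
  exact ((locallyIntegrable_abs_fst_rpow (by linarith)).locallyIntegrableOn
    halfPlane).continuousOn_mul hcont isOpen_halfPlane.isLocallyClosed

lemma locallyIntegrableOn_speedDensity_mul_sq_halfPlane (hβ : -1 < 2 * β - β * (1 + j)) :
    LocallyIntegrableOn (fun p => speedDensity ρ β j p * (p.2 * |p.1| ^ β) ^ 2) halfPlane := by
  refine (((locallyIntegrable_abs_fst_rpow hβ).locallyIntegrableOn halfPlane).smul
    (√(1 - ρ ^ 2))⁻¹).congr ?_
  filter_upwards [ae_fst_ne_zero, ae_restrict_mem measurableSet_halfPlane] with p hx hy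
  exact (speedDensity_mul_sq_eq_mul_abs_rpow hx (ne_of_gt hy)).symm

lemma continuousOn_abs_fst_rpow_quadrant (s : ℝ) :
    ContinuousOn (fun p : ℝ × ℝ => |p.1| ^ s) quadrant :=
  continuousOn_fst.abs.rpow_const fun _ hp => .inl (abs_ne_zero.2 (ne_of_gt hp.1))

lemma continuousOn_speedDensity_quadrant : ContinuousOn (speedDensity ρ β j) quadrant := by
  rw [funext speedDensity_eq_mul_abs_rpow]
  exact (continuousOn_const.mul ((continuousOn_snd.pow 2).inv₀ fun p hp =>
    pow_ne_zero 2 (ne_of_gt hp.2))).mul (continuousOn_abs_fst_rpow_quadrant _)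

lemma locallyIntegrableOn_speedDensity_quadrant :
    LocallyIntegrableOn (speedDensity ρ β j) quadrant :=
  continuousOn_speedDensity_quadrant.locallyIntegrableOn isOpen_quadrant.measurableSet

lemma locallyIntegrableOn_speedDensity_mul_sq_quadrant :
    LocallyIntegrableOn (fun p => speedDensity ρ β j p * (p.2 * |p.1| ^ β) ^ 2) quadrant :=
  (continuousOn_speedDensity_quadrant.mul ((continuousOn_snd.mul
    (continuousOn_abs_fst_rpow_quadrant β)).pow 2)).locallyIntegrableOn
      isOpen_quadrant.measurableSet

lemma locallyIntegrableOn_speedDensity_mul (hUo : IsOpen U) (hU : U ⊆ halfPlane)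
    (hm : LocallyIntegrableOn (speedDensity ρ β j) U) (hv : MemLp v 2 (speedMeasure ρ β j)) :
    LocallyIntegrableOn (fun p => speedDensity ρ β j p * v p) U := by
  refine (locallyIntegrableOn_iff hUo.isLocallyClosed).2 fun K hKU hK => ?_
  have hmeas : Measurable (K.indicator fun _ => (1 : ℝ)) :=
    measurable_const.indicator hK.measurableSet
  have hone : MemLp (K.indicator fun _ => (1 : ℝ)) 2 (speedMeasure ρ β j) := by
    rw [memLp_two_iff_integrable_sq hmeas.aestronglyMeasurable, integrable_speedMeasure_iff]
    refine ((hm.integrableOn_compact_subset hKU hK).integrable_indicator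
      hK.measurableSet).integrableOn.congr (.of_forall fun p => ?_)
    by_cases hp : p ∈ K <;> simp [hp]
  refine ((integrable_speedMeasure_iff.1 (hone.integrable_mul hv)).mono_set
    (hKU.trans hU)).congr_fun (fun p hp => ?_) hK.measurableSet
  simp only [Pi.mul_apply, indicator_of_mem hp, one_mul]

namespace IsTest

lemma memLp_mul (hf : IsTest U f) {c : ℝ × ℝ → ℝ} (hc : Measurable c)
    (hU : LocallyIntegrableOn (fun p => speedDensity ρ β j p * c p ^ 2) U) :
    MemLp (fun p => c p * f p) 2 (speedMeasure ρ β j) := by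
  have hmeas : Measurable fun p => c p * f p := hc.mul hf.1.continuous.measurable
  have hsq : IsTest U fun p => f p * f p :=
    ⟨hf.1.mul hf.1, hf.2.1.mul_left, tsupport_mul_subset_right.trans hf.2.2⟩
  rw [memLp_two_iff_integrable_sq hmeas.aestronglyMeasurable, integrable_speedMeasure_iff]
  refine (hsq.integrable_mul hU).integrableOn.congr (.of_forall fun p => ?_)
  ring

lemma memLp (hf : IsTest U f) (hm : LocallyIntegrableOn (speedDensity ρ β j) U) :
    MemLp f 2 (speedMeasure ρ β j) := by
  simpa only [one_mul] using
    hf.memLp_mul (c := fun _ => 1) measurable_const (by simpa only [one_pow, mul_one] using hm)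

end IsTest

/-- The classical gradient of a differentiable function. -/
def smoothGrad (f : ℝ × ℝ → ℝ) (p : ℝ × ℝ) : ℝ × ℝ := (partialX f p, partialY f p)

namespace IsTest

lemma hasGrad (hf : IsTest U f) : HasGrad f (smoothGrad f) :=
  hasGrad_of_contDiff (hf.1.of_le (by simp))

lemma memLp_frameX (hf : IsTest U f)
    (hx : LocallyIntegrableOn (fun p => speedDensity ρ β j p * (p.2 * |p.1| ^ β) ^ 2) U) :
    MemLp (frameX β (smoothGrad f)) 2 (speedMeasure ρ β j) :=
  hf.partialX.memLp_mul (by fun_prop) hx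

lemma memLp_frameY (hf : IsTest U f) (hm : LocallyIntegrableOn (speedDensity ρ β j) U) :
    MemLp (frameY (smoothGrad f)) 2 (speedMeasure ρ β j) := by
  have hfy : IsTest U (frameY (smoothGrad f)) :=
    ⟨contDiff_snd.mul hf.partialY.1, hf.partialY.2.1.mul_left,
      tsupport_mul_subset_right.trans hf.partialY.2.2⟩
  exact hfy.memLp hm

lemma mem_gradientGraph (hρ : -1 < ρ ∧ ρ < 1) (hf : IsTest U f)
    (hm : LocallyIntegrableOn (speedDensity ρ β j) U)
    (hx : LocallyIntegrableOn (fun p => speedDensity ρ β j p * (p.2 * |p.1| ^ β) ^ 2) U)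
    {u : HilbertL2 ρ β j} (hu : u =ᵐ[speedMeasure ρ β j] f) :
    (u, (hf.memLp_frameX hx).toLp _, (hf.memLp_frameY hm).toLp _) ∈ gradientGraph hρ β j :=
  (hf.hasGrad.congr_speedMeasure hρ hu.symm).mem_gradientGraph hρ _ _

lemma mem_energyDomain (hρ : -1 < ρ ∧ ρ < 1) (hf : IsTest U f)
    (hm : LocallyIntegrableOn (speedDensity ρ β j) U)
    (hx : LocallyIntegrableOn (fun p => speedDensity ρ β j p * (p.2 * |p.1| ^ β) ^ 2) U)
    {u : HilbertL2 ρ β j} (hu : u =ᵐ[speedMeasure ρ β j] f) : u ∈ energyDomain ρ β j :=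
  (isGraphForm_energy hρ).mem_iff.2 ⟨_, hf.mem_gradientGraph hρ hm hx hu⟩

lemma energy_eq (hρ : -1 < ρ ∧ ρ < 1) (hf₁ : IsTest U f₁) (hf₂ : IsTest U f₂)
    {u₁ u₂ : HilbertL2 ρ β j} (hu₁ : u₁ =ᵐ[speedMeasure ρ β j] f₁)
    (hu₂ : u₂ =ᵐ[speedMeasure ρ β j] f₂) :
    energy ρ β j u₁ u₂ = (1 / 2) * ∫ p, gammaSmooth ρ β f₁ f₂ p ∂speedMeasure ρ β j :=
  energy_eq_integral_gammaGrad hρ (hf₁.hasGrad.congr_speedMeasure hρ hu₁.symm)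
    (hf₂.hasGrad.congr_speedMeasure hρ hu₂.symm)

lemma integrable_gammaSmooth (hf₁ : IsTest U f₁) (hf₂ : IsTest U f₂)
    (hm : LocallyIntegrableOn (speedDensity ρ β j) U)
    (hx : LocallyIntegrableOn (fun p => speedDensity ρ β j p * (p.2 * |p.1| ^ β) ^ 2) U) :
    Integrable (gammaSmooth ρ β f₁ f₂) (speedMeasure ρ β j) :=
  integrable_gammaGrad (k := ((hf₁.memLp_frameX hx).toLp _, (hf₁.memLp_frameY hm).toLp _))
    (l := ((hf₂.memLp_frameX hx).toLp _, (hf₂.memLp_frameY hm).toLp _))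
    (hf₁.memLp_frameX hx).coeFn_toLp (hf₁.memLp_frameY hm).coeFn_toLp
    (hf₂.memLp_frameX hx).coeFn_toLp (hf₂.memLp_frameY hm).coeFn_toLp

end IsTest

/-- `C_0^∞(S)` as a submodule of `H_j`. -/
def testSubmodule (ρ β : ℝ) (j : ℕ) : Submodule ℝ (HilbertL2 ρ β j) where
  carrier := testDomain ρ β j
  zero_mem' := ⟨fun _ => 0, .zero, Lp.coeFn_zero _ _ _⟩
  add_mem' := by
    rintro u v ⟨f, hf, hu⟩ ⟨f', hf', hv⟩
    exact ⟨_, hf.add hf', (Lp.coeFn_add u v).trans (hu.add hv)⟩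
  smul_mem' := by
    rintro c u ⟨f, hf, hu⟩
    exact ⟨_, hf.const_mul c, (Lp.coeFn_smul c u).trans (hu.const_smul c)⟩

lemma dense_testDomain (hρ : -1 < ρ ∧ ρ < 1) (hβ : β * (1 + j) < 1) :
    Dense (testDomain ρ β j) := by
  have hm := locallyIntegrableOn_speedDensity_halfPlane (ρ := ρ) hβ
  change Dense (testSubmodule ρ β j : Set (HilbertL2 ρ β j))
  rw [Submodule.dense_iff_topologicalClosure_eq_top, Submodule.topologicalClosure_eq_top_iff,
    Submodule.eq_bot_iff]
  intro h hh
  have hzero := isOpen_halfPlane.ae_eq_zero_of_integral_contDiff_smul_eq_zero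
    (locallyIntegrableOn_speedDensity_mul isOpen_halfPlane subset_rfl hm (Lp.memLp h))
    fun f hsmooth hcomp hsupp => by
      have hf : IsTest halfPlane f := ⟨hsmooth, hcomp, hsupp⟩
      have hu := (hf.memLp hm).coeFn_toLp
      have horth : inner ℝ _ h = 0 :=
        (Submodule.mem_orthogonal _ _).1 hh _ ⟨f, hf, hu⟩
      rw [inner_eq_integral hu .rfl, integral_speedMeasure] at horth
      rw [← horth, ← setIntegral_eq_integral_of_forall_compl_eq_zero (s := halfPlane)]
      · simp only [smul_eq_mul, mul_left_comm]
      · intro p hp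
        rw [hf.eq_zero hp, zero_smul]
  refine Lp.ext (EventuallyEq.trans ?_ (Lp.coeFn_zero _ _ _).symm)
  rw [EventuallyEq, ae_speedMeasure hρ]
  filter_upwards [ae_fst_ne_zero, ae_restrict_of_ae hzero,
    ae_restrict_mem measurableSet_halfPlane] with p hx hp hy
  exact (mul_eq_zero.1 (hp hy)).resolve_left (speedDensity_pos hρ hx (ne_of_gt hy)).ne'

lemma testDomain_subset_energyDomain (hρ : -1 < ρ ∧ ρ < 1) (hβ : β * (1 + j) < 1)
    (hβ' : -1 < 2 * β - β * (1 + j)) : testDomain ρ β j ⊆ energyDomain ρ β j :=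
  fun _ ⟨_, hf, hu⟩ => hf.mem_energyDomain hρ (locallyIntegrableOn_speedDensity_halfPlane hβ)
    (locallyIntegrableOn_speedDensity_mul_sq_halfPlane hβ') hu

lemma dense_energyDomain (hρ : -1 < ρ ∧ ρ < 1) (hβ : β * (1 + j) < 1)
    (hβ' : -1 < 2 * β - β * (1 + j)) : Dense (energyDomain ρ β j) :=
  (dense_testDomain hρ hβ).mono (testDomain_subset_energyDomain hρ hβ hβ')

end TestFunctionsInDomain

section GreenFormula

/-! ### Green's formula -/

variable {ρ β : ℝ} {j : ℕ} {U : Set (ℝ × ℝ)} {f v P : ℝ × ℝ → ℝ} {g : ℝ × ℝ → ℝ × ℝ}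

lemma isClosedEmbedding_prodMk_right {X Y : Type*} [TopologicalSpace X] [T2Space X]
    [TopologicalSpace Y] [T2Space Y] (x : X) : IsClosedEmbedding fun y : Y => (x, y) :=
  Function.LeftInverse.isClosedEmbedding (f := Prod.snd) (fun _ => rfl) continuous_snd
    (Continuous.prodMk_right x)

namespace IsTest

lemma integral_mul_partialY (hU : U ⊆ halfPlane) (hP : IsTest U P) (hg : HasGrad v g)
    (hv : LocallyIntegrableOn v U) (hgy : LocallyIntegrableOn (fun p => (g p).2) U) :
    ∫ p in halfPlane, P p * (g p).2 = -∫ p in halfPlane, SABR.partialY P p * v p := by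
  have hPg := (hP.integrable_mul hgy).restrict (s := halfPlane)
  have hPv := (hP.partialY.integrable_mul hv).restrict (s := halfPlane)
  rw [volume_restrict_halfPlane] at hPg hPv ⊢
  refine hg.snd.integral_mul_eq_neg isOpen_Ioi (.of_forall fun x => ?_) (.of_forall fun x => ?_)
    (.of_forall fun x => ?_) hPg hPv
  · exact (hP.1.of_le (by simp)).comp (contDiff_const.prodMk contDiff_id)
  · exact hP.2.1.comp_isClosedEmbedding (isClosedEmbedding_prodMk_right x)
  · exact (tsupport_comp_subset_preimage P (Continuous.prodMk_right x)).trans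
      fun t ht => hU (hP.2.2 ht)

lemma integral_mul_partialX (hP : IsTest U P) (hg : HasGrad v g)
    (hv : LocallyIntegrableOn v U) (hgx : LocallyIntegrableOn (fun p => (g p).1) U) :
    ∫ p in halfPlane, P p * (g p).1 = -∫ p in halfPlane, SABR.partialX P p * v p := by
  have hswap := measurePreserving_swap_halfPlane
  have hemb : MeasurableEmbedding (Prod.swap : ℝ × ℝ → ℝ × ℝ) :=
    MeasurableEquiv.prodComm.measurableEmbedding
  rw [← hswap.integral_comp hemb, ← hswap.integral_comp hemb]
  refine hg.fst.integral_mul_eq_neg (P := P ∘ Prod.swap) isOpen_univ (.of_forall fun y => ?_)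
    (.of_forall fun y => ?_) (.of_forall fun y => subset_univ _)
    ((hswap.integrable_comp_emb hemb).2 (hP.integrable_mul hgx).restrict)
    ((hswap.integrable_comp_emb hemb).2 (hP.partialX.integrable_mul hv).restrict)
  · exact (hP.1.of_le (by simp)).comp (contDiff_id.prodMk contDiff_const)
  · exact (hP.2.1.comp_homeomorph (Homeomorph.prodComm ℝ ℝ)).comp_isClosedEmbedding
      (isClosedEmbedding_prodMk_right y)

end IsTest

lemma locallyIntegrableOn_quadrant_of_memLp (hρ : -1 < ρ ∧ ρ < 1)
    (hv : MemLp v 2 (speedMeasure ρ β j)) : LocallyIntegrableOn v quadrant := by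
  have hpos : ∀ p ∈ quadrant, speedDensity ρ β j p ≠ 0 := fun p hp =>
    (speedDensity_pos hρ (ne_of_gt hp.1) (ne_of_gt hp.2)).ne'
  refine ((locallyIntegrableOn_speedDensity_mul isOpen_quadrant quadrant_subset_halfPlane
    locallyIntegrableOn_speedDensity_quadrant hv).continuousOn_mul
      (continuousOn_speedDensity_quadrant.inv₀ hpos) isOpen_quadrant.isLocallyClosed).congr ?_
  filter_upwards [ae_restrict_mem isOpen_quadrant.measurableSet] with p hp
  exact inv_mul_cancel_left₀ (hpos p hp) _

lemma locallyIntegrableOn_quadrant_of_memLp_frameX (hρ : -1 < ρ ∧ ρ < 1)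
    (hgx : MemLp (frameX β g) 2 (speedMeasure ρ β j)) :
    LocallyIntegrableOn (fun p => (g p).1) quadrant := by
  have hne : ∀ p ∈ quadrant, p.2 * |p.1| ^ β ≠ 0 := fun p hp =>
    mul_ne_zero (ne_of_gt hp.2) (Real.rpow_pos_of_pos (abs_pos.2 (ne_of_gt hp.1)) _).ne'
  refine ((locallyIntegrableOn_quadrant_of_memLp hρ hgx).continuousOn_mul
    ((continuousOn_snd.mul (continuousOn_abs_fst_rpow_quadrant β)).inv₀ hne)
      isOpen_quadrant.isLocallyClosed).congr ?_
  filter_upwards [ae_restrict_mem isOpen_quadrant.measurableSet] with p hp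
  exact inv_mul_cancel_left₀ (hne p hp) _

lemma locallyIntegrableOn_quadrant_of_memLp_frameY (hρ : -1 < ρ ∧ ρ < 1)
    (hgy : MemLp (frameY g) 2 (speedMeasure ρ β j)) :
    LocallyIntegrableOn (fun p => (g p).2) quadrant := by
  have hne : ∀ p ∈ quadrant, p.2 ≠ 0 := fun p hp => ne_of_gt hp.2
  refine ((locallyIntegrableOn_quadrant_of_memLp hρ hgy).continuousOn_mul
    (continuousOn_snd.inv₀ hne) isOpen_quadrant.isLocallyClosed).congr ?_
  filter_upwards [ae_restrict_mem isOpen_quadrant.measurableSet] with p hp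
  exact inv_mul_cancel_left₀ (hne p hp) _

/-- The `x`-component of the flux `m_j a ∇f` (up to the factor `1 / √(1 - ρ²)`), where `a` is the
coefficient matrix of `Γ`. -/
def fluxX (ρ β : ℝ) (j : ℕ) (f : ℝ × ℝ → ℝ) (p : ℝ × ℝ) : ℝ :=
  p.1 ^ (2 * β - β * (1 + j)) * partialX f p + ρ * (p.1 ^ (β - β * (1 + j)) * partialY f p)

/-- The `y`-component of the flux `m_j a ∇f` (up to the factor `1 / √(1 - ρ²)`), where `a` is the
coefficient matrix of `Γ`. -/
def fluxY (ρ β : ℝ) (j : ℕ) (f : ℝ × ℝ → ℝ) (p : ℝ × ℝ) : ℝ :=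
  ρ * (p.1 ^ (β - β * (1 + j)) * partialX f p) + p.1 ^ (-(β * (1 + j))) * partialY f p

/-- The operator `(2 m_j)⁻¹ div (m_j a ∇f)` associated with the energy form on the quadrant, where
`a` is the coefficient matrix of `Γ`. -/
def divOperator (ρ β : ℝ) (j : ℕ) (f : ℝ × ℝ → ℝ) (p : ℝ × ℝ) : ℝ :=
  1 / 2 * (p.2 ^ 2 * (p.1 ^ (β * (1 + j)) *
    (partialX (fluxX ρ β j f) p + partialY (fluxY ρ β j f) p)))

namespace IsTest

protected lemma fluxX (hf : IsTest quadrant f) : IsTest quadrant (fluxX ρ β j f) :=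
  (hf.partialX.rpow_mul _).add ((hf.partialY.rpow_mul _).const_mul ρ)

protected lemma fluxY (hf : IsTest quadrant f) : IsTest quadrant (fluxY ρ β j f) :=
  ((hf.partialX.rpow_mul _).const_mul ρ).add (hf.partialY.rpow_mul _)

protected lemma divOperator (hf : IsTest quadrant f) : IsTest quadrant (divOperator ρ β j f) :=
  (((hf.fluxX.partialX.add hf.fluxY.partialY).rpow_mul _).mul_of_contDiffOn isOpen_quadrant
    (contDiff_snd.pow 2).contDiffOn).const_mul _

end IsTest

lemma speedDensity_mul_gammaGrad (hf : IsTest quadrant f) (p : ℝ × ℝ) :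
    speedDensity ρ β j p * gammaGrad ρ β p (smoothGrad f p) (g p) =
      (√(1 - ρ ^ 2))⁻¹ * (fluxX ρ β j f p * (g p).1 + fluxY ρ β j f p * (g p).2) := by
  by_cases hp : p ∈ quadrant
  · have hx : 0 < p.1 := hp.1
    have hy : 0 < p.2 := hp.2
    simp only [speedDensity, gammaGrad, smoothGrad, fluxX, fluxY, abs_of_pos hx,
      Real.rpow_sub hx, Real.rpow_neg hx.le]
    field_simp
    ring
  · rw [hf.fluxX.eq_zero hp, hf.fluxY.eq_zero hp, smoothGrad, hf.partialX.eq_zero hp,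
      hf.partialY.eq_zero hp]
    simp [gammaGrad]

lemma speedDensity_mul_divOperator (hf : IsTest quadrant f) (p : ℝ × ℝ) :
    speedDensity ρ β j p * divOperator ρ β j f p = (√(1 - ρ ^ 2))⁻¹ *
      (1 / 2 * (partialX (fluxX ρ β j f) p + partialY (fluxY ρ β j f) p)) := by
  by_cases hp : p ∈ quadrant
  · have hx : 0 < p.1 := hp.1
    have hy : 0 < p.2 := hp.2
    simp only [speedDensity, divOperator, abs_of_pos hx]
    field_simp
  · rw [hf.divOperator.eq_zero hp, hf.fluxX.partialX.eq_zero hp, hf.fluxY.partialY.eq_zero hp]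
    simp

lemma integral_gammaGrad_eq_integral_flux (hf : IsTest quadrant f)
    (hgx : LocallyIntegrableOn (fun p => (g p).1) quadrant)
    (hgy : LocallyIntegrableOn (fun p => (g p).2) quadrant) :
    ∫ p, gammaGrad ρ β p (smoothGrad f p) (g p) ∂speedMeasure ρ β j =
      (√(1 - ρ ^ 2))⁻¹ * ((∫ p in halfPlane, fluxX ρ β j f p * (g p).1) +
        ∫ p in halfPlane, fluxY ρ β j f p * (g p).2) := by
  simp_rw [integral_speedMeasure, speedDensity_mul_gammaGrad hf]
  rw [integral_const_mul, integral_add (hf.fluxX.integrable_mul hgx).integrableOn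
    (hf.fluxY.integrable_mul hgy).integrableOn]

lemma integral_divOperator_mul_eq_integral_flux (hf : IsTest quadrant f)
    (hv : LocallyIntegrableOn v quadrant) :
    ∫ p, divOperator ρ β j f p * v p ∂speedMeasure ρ β j =
      (√(1 - ρ ^ 2))⁻¹ * (1 / 2 * ((∫ p in halfPlane, partialX (fluxX ρ β j f) p * v p) +
        ∫ p in halfPlane, partialY (fluxY ρ β j f) p * v p)) := by
  simp_rw [integral_speedMeasure, ← mul_assoc, speedDensity_mul_divOperator hf, mul_assoc, add_mul]
  rw [integral_const_mul, integral_const_mul,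
    integral_add (hf.fluxX.partialX.integrable_mul hv).integrableOn
      (hf.fluxY.partialY.integrable_mul hv).integrableOn]

lemma integral_divOperator_mul (hρ : -1 < ρ ∧ ρ < 1) (hf : IsTest quadrant f)
    (hv : MemLp v 2 (speedMeasure ρ β j)) (hg : HasGrad v g)
    (hgx : MemLp (frameX β g) 2 (speedMeasure ρ β j))
    (hgy : MemLp (frameY g) 2 (speedMeasure ρ β j)) :
    ∫ p, divOperator ρ β j f p * v p ∂speedMeasure ρ β j =
      -((1 / 2) * ∫ p, gammaGrad ρ β p (smoothGrad f p) (g p) ∂speedMeasure ρ β j) := by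
  have hv' := locallyIntegrableOn_quadrant_of_memLp hρ hv
  have hgx' := locallyIntegrableOn_quadrant_of_memLp_frameX hρ hgx
  have hgy' := locallyIntegrableOn_quadrant_of_memLp_frameY hρ hgy
  rw [integral_divOperator_mul_eq_integral_flux hf hv',
    integral_gammaGrad_eq_integral_flux hf hgx' hgy',
    hf.fluxX.integral_mul_partialX hg hv' hgx',
    hf.fluxY.integral_mul_partialY quadrant_subset_halfPlane hg hv' hgy']
  ring

/-- `L` is `divOperator ρ β j` on the test functions of the quadrant; the identities of the theorem
between an operator in non-divergence form and the energy form hold for every such `L`. -/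
def IsDivOperator (ρ β : ℝ) (j : ℕ) (L : (ℝ × ℝ → ℝ) → ℝ × ℝ → ℝ) : Prop :=
  ∀ f, IsTest quadrant f → L f = divOperator ρ β j f

namespace IsDivOperator

variable {L : (ℝ × ℝ → ℝ) → ℝ × ℝ → ℝ}

lemma formIdentity (hρ : -1 < ρ ∧ ρ < 1) (hL : IsDivOperator ρ β j L) :
    FormIdentity ρ β j L := by
  intro f₁ f₂ hf₁ hf₂
  rw [hL f₁ hf₁]
  exact integral_divOperator_mul hρ hf₁ (hf₂.memLp locallyIntegrableOn_speedDensity_quadrant)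
    hf₂.hasGrad (hf₂.memLp_frameX locallyIntegrableOn_speedDensity_mul_sq_quadrant)
    (hf₂.memLp_frameY locallyIntegrableOn_speedDensity_quadrant)

lemma memLp (hL : IsDivOperator ρ β j L) (hf : IsTest quadrant f) :
    MemLp (L f) 2 (speedMeasure ρ β j) :=
  hL f hf ▸ hf.divOperator.memLp locallyIntegrableOn_speedDensity_quadrant

lemma energy_eq_neg_inner (hρ : -1 < ρ ∧ ρ < 1) (hL : IsDivOperator ρ β j L)
    (hf : IsTest quadrant f) {u v : HilbertL2 ρ β j} (hu : u =ᵐ[speedMeasure ρ β j] f)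
    (hv : v ∈ energyDomain ρ β j) :
    energy ρ β j u v = -inner ℝ ((hL.memLp hf).toLp (L f)) v := by
  obtain ⟨k, g, hg, hgx, hgy⟩ := (isGraphForm_energy hρ).mem_iff.1 hv
  rw [inner_eq_integral (hL.memLp hf).coeFn_toLp .rfl,
    energy_eq_integral_gammaGrad hρ (hf.hasGrad.congr_speedMeasure hρ hu.symm) hg, hL f hf,
    integral_divOperator_mul hρ hf (Lp.memLp v) hg ((Lp.memLp k.1).ae_eq hgx)
      ((Lp.memLp k.2).ae_eq hgy), neg_neg]

lemma generatorAgrees (hρ : -1 < ρ ∧ ρ < 1) (hdense : Dense (energyDomain ρ β j))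
    (hL : IsDivOperator ρ β j L) : GeneratorAgrees ρ β j L := by
  intro f₁ hf₁ u₁ hu₁
  have hdom : ∀ {f : ℝ × ℝ → ℝ} {u : HilbertL2 ρ β j}, IsTest quadrant f →
      u =ᵐ[speedMeasure ρ β j] f → u ∈ energyDomain ρ β j := fun hf hu =>
    hf.mem_energyDomain hρ locallyIntegrableOn_speedDensity_quadrant
      locallyIntegrableOn_speedDensity_mul_sq_quadrant hu
  have henergy := fun v hv => hL.energy_eq_neg_inner hρ hf₁ hu₁ (v := v) hv
  have hLp := (hL.memLp hf₁).coeFn_toLp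
  refine ⟨⟨hdom hf₁ hu₁, _, henergy⟩, ?_, fun f₂ hf₂ u₂ hu₂ => ?_⟩
  · rwa [generator_eq hdense henergy]
  · rw [generator_eq hdense henergy, ← inner_eq_integral hLp hu₂, henergy u₂ (hdom hf₂ hu₂),
      neg_neg]
    exact ⟨rfl, rfl⟩

end IsDivOperator

end GreenFormula

section Operators

/-! ### The SABR operators in divergence form -/

variable {ρ β : ℝ} {j : ℕ} {U : Set (ℝ × ℝ)} {f : ℝ × ℝ → ℝ} {p : ℝ × ℝ}

namespace IsTest

lemma hasDerivAt_fst (hf : IsTest U f) (p : ℝ × ℝ) :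
    HasDerivAt (fun s => f (s, p.2)) (SABR.partialX f p) p.1 :=
  (hasDerivAt_partialX hf.differentiable p).differentiableAt.hasDerivAt

lemma hasDerivAt_snd (hf : IsTest U f) (p : ℝ × ℝ) :
    HasDerivAt (fun t => f (p.1, t)) (SABR.partialY f p) p.2 :=
  (hasDerivAt_partialY hf.differentiable p).differentiableAt.hasDerivAt

lemma hasDerivAt_rpow_mul (hf : IsTest U f) (a : ℝ) (hp : 0 < p.1) :
    HasDerivAt (fun s => s ^ a * f (s, p.2))
      (a * p.1 ^ (a - 1) * f p + p.1 ^ a * SABR.partialX f p) p.1 :=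
  (Real.hasDerivAt_rpow_const (.inl hp.ne')).mul (hf.hasDerivAt_fst p)

lemma partialX_fluxX (hf : IsTest quadrant f) (hp : 0 < p.1) :
    SABR.partialX (SABR.fluxX ρ β j f) p =
      (2 * β - β * (1 + j)) * p.1 ^ (2 * β - β * (1 + j) - 1) * SABR.partialX f p
      + p.1 ^ (2 * β - β * (1 + j)) * SABR.partialX (SABR.partialX f) p
      + ρ * ((β - β * (1 + j)) * p.1 ^ (β - β * (1 + j) - 1) * SABR.partialY f p
      + p.1 ^ (β - β * (1 + j)) * SABR.partialX (SABR.partialY f) p) :=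
  ((hf.partialX.hasDerivAt_rpow_mul _ hp).add
    ((hf.partialY.hasDerivAt_rpow_mul _ hp).const_mul ρ)).deriv

lemma partialY_fluxY (hf : IsTest quadrant f) :
    SABR.partialY (SABR.fluxY ρ β j f) p =
      ρ * (p.1 ^ (β - β * (1 + j)) * SABR.partialX (SABR.partialY f) p)
      + p.1 ^ (-(β * (1 + j))) * SABR.partialY (SABR.partialY f) p := by
  rw [hf.partialX_partialY]
  exact ((((hf.partialX.hasDerivAt_snd p).const_mul (p.1 ^ (β - β * (1 + j)))).const_mul ρ).add
    ((hf.partialY.hasDerivAt_snd p).const_mul (p.1 ^ (-(β * (1 + j)))))).deriv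

lemma sabrGenerator_eq_zero (hf : IsTest quadrant f) (hp : p ∉ quadrant) :
    sabrGenerator ρ β f p = 0 := by
  rw [sabrGenerator, hf.partialX.partialX.eq_zero hp, hf.partialY.partialX.eq_zero hp,
    hf.partialY.partialY.eq_zero hp]
  simp

end IsTest

lemma rpow_two_mul_eq_mul {x : ℝ} (hx : 0 < x) (s : ℝ) : x ^ (2 * s) = x ^ s * x ^ s := by
  rw [two_mul, Real.rpow_add hx]

lemma isDivOperator_sabrLaplace : IsDivOperator ρ β 0 (sabrLaplace ρ β) := by
  intro f hf
  funext p
  by_cases hp : p ∈ quadrant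
  · have hx : 0 < p.1 := hp.1
    have hpow : p.1 ^ (2 * β - 1) = p.1 ^ β * p.1 ^ (β - 1) := by
      rw [← Real.rpow_add hx, two_mul, add_sub_assoc]
    have hexp : 2 * β - β = β := by ring
    rw [divOperator, hf.partialX_fluxX hx, hf.partialY_fluxY, sabrLaplace, sabrGenerator, hpow,
      rpow_two_mul_eq_mul hx, Nat.cast_zero, add_zero, mul_one, sub_self, Real.rpow_zero,
      Real.rpow_neg hx.le, hexp]
    field_simp
    ring
  · rw [hf.divOperator.eq_zero hp, sabrLaplace, hf.sabrGenerator_eq_zero hp,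
      hf.partialX.eq_zero hp, mul_zero, add_zero]

lemma isDivOperator_sabrGenerator_of_beta_eq_zero : IsDivOperator ρ 0 0 (sabrGenerator ρ 0) := by
  intro f hf
  rw [← isDivOperator_sabrLaplace f hf]
  funext p
  simp [sabrLaplace]

lemma isDivOperator_sabrGenerator_of_rho_eq_zero : IsDivOperator 0 β 1 (sabrGenerator 0 β) := by
  intro f hf
  funext p
  by_cases hp : p ∈ quadrant
  · have hx : 0 < p.1 := hp.1
    rw [divOperator, hf.partialX_fluxX hx, hf.partialY_fluxY, sabrGenerator, Nat.cast_one,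
      one_add_one_eq_two, mul_comm β 2, sub_self, Real.rpow_zero, Real.rpow_neg hx.le]
    field_simp
    ring
  · rw [hf.divOperator.eq_zero hp, hf.sabrGenerator_eq_zero hp]

/-! ### The Laplace–Beltrami operator -/

lemma sqrt_det_sabrMetric (hρ : -1 < ρ ∧ ρ < 1) (hp : p ∈ quadrant) :
    √(sabrMetric ρ β p).det = (√(1 - ρ ^ 2) * p.1 ^ β * p.2 ^ 2)⁻¹ := by
  have hx : 0 < p.1 := hp.1
  have hy : 0 < p.2 := hp.2
  have hr : 0 < 1 - ρ ^ 2 := Real.sqrt_pos.1 (sqrt_one_sub_sq_pos hρ)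
  rw [← Real.sqrt_sq (by positivity : 0 ≤ (√(1 - ρ ^ 2) * p.1 ^ β * p.2 ^ 2)⁻¹), sabrMetric,
    Matrix.det_smul, Matrix.det_fin_two_of, rpow_two_mul_eq_mul hx, Fintype.card_fin, inv_pow,
    mul_pow, mul_pow, Real.sq_sqrt hr.le]
  congr 1
  field_simp

lemma inv_sabrMetric (hρ : -1 < ρ ∧ ρ < 1) (hp : p ∈ quadrant) :
    (sabrMetric ρ β p)⁻¹ = !![p.2 ^ 2 * p.1 ^ (2 * β), ρ * p.2 ^ 2 * p.1 ^ β;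
      ρ * p.2 ^ 2 * p.1 ^ β, p.2 ^ 2] := by
  have hx : 0 < p.1 := hp.1
  have hy : 0 < p.2 := hp.2
  have hr : 0 < 1 - ρ ^ 2 := Real.sqrt_pos.1 (sqrt_one_sub_sq_pos hρ)
  refine Matrix.inv_eq_right_inv ?_
  rw [sabrMetric, rpow_two_mul_eq_mul hx, Matrix.smul_mul, Matrix.mul_fin_two,
    Matrix.one_fin_two]
  simp only [Matrix.smul_of, Matrix.smul_cons, Matrix.smul_empty, smul_eq_mul]
  congrm !![?_, ?_; ?_, ?_] <;> field_simp <;> ring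

lemma sqrt_det_mul_inv_sabrMetric_fst (hρ : -1 < ρ ∧ ρ < 1) (hp : p ∈ quadrant) :
    √(sabrMetric ρ β p).det *
      ((sabrMetric ρ β p)⁻¹ 0 0 * partialX f p + (sabrMetric ρ β p)⁻¹ 0 1 * partialY f p) =
      (√(1 - ρ ^ 2))⁻¹ * fluxX ρ β 0 f p := by
  have hx : 0 < p.1 := hp.1
  have hy : 0 < p.2 := hp.2
  have hexp : 2 * β - β = β := by ring
  rw [sqrt_det_sabrMetric hρ hp, inv_sabrMetric hρ hp, fluxX, Nat.cast_zero, add_zero, mul_one,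
    sub_self, Real.rpow_zero, hexp, rpow_two_mul_eq_mul hx]
  simp only [Matrix.of_apply, Matrix.cons_val_zero, Matrix.cons_val_one]
  field_simp

lemma sqrt_det_mul_inv_sabrMetric_snd (hρ : -1 < ρ ∧ ρ < 1) (hp : p ∈ quadrant) :
    √(sabrMetric ρ β p).det *
      ((sabrMetric ρ β p)⁻¹ 1 0 * partialX f p + (sabrMetric ρ β p)⁻¹ 1 1 * partialY f p) =
      (√(1 - ρ ^ 2))⁻¹ * fluxY ρ β 0 f p := by
  have hx : 0 < p.1 := hp.1
  have hy : 0 < p.2 := hp.2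
  rw [sqrt_det_sabrMetric hρ hp, inv_sabrMetric hρ hp, fluxY, Nat.cast_zero, add_zero, mul_one,
    sub_self, Real.rpow_zero, Real.rpow_neg hx.le]
  simp only [Matrix.of_apply, Matrix.cons_val_zero, Matrix.cons_val_one]
  field_simp

lemma partialX_eq_const_mul_of_eqOn (hf : IsTest quadrant f) {F : ℝ × ℝ → ℝ} {c : ℝ}
    (hF : ∀ q ∈ quadrant, F q = c * f q) (hp : p ∈ quadrant) :
    partialX F p = c * partialX f p := by
  have hmem : ∀ᶠ s in 𝓝 p.1, (s, p.2) ∈ quadrant :=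
    (Continuous.prodMk_left p.2).continuousAt.preimage_mem_nhds (isOpen_quadrant.mem_nhds hp)
  exact (((hf.hasDerivAt_fst p).const_mul c).congr_of_eventuallyEq
    (hmem.mono fun _ => hF _)).deriv

lemma partialY_eq_const_mul_of_eqOn (hf : IsTest quadrant f) {F : ℝ × ℝ → ℝ} {c : ℝ}
    (hF : ∀ q ∈ quadrant, F q = c * f q) (hp : p ∈ quadrant) :
    partialY F p = c * partialY f p := by
  have hmem : ∀ᶠ t in 𝓝 p.2, (p.1, t) ∈ quadrant :=
    (Continuous.prodMk_right p.1).continuousAt.preimage_mem_nhds (isOpen_quadrant.mem_nhds hp)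
  exact (((hf.hasDerivAt_snd p).const_mul c).congr_of_eventuallyEq
    (hmem.mono fun _ => hF _)).deriv

lemma sabrLaplace_eq_laplaceBeltrami (hρ : -1 < ρ ∧ ρ < 1) (hf : IsTest quadrant f)
    (hp : p ∈ quadrant) :
    sabrLaplace ρ β f p = (1 / 2) * laplaceBeltrami (sabrMetric ρ β) f p := by
  have hr := sqrt_one_sub_sq_pos hρ
  rw [isDivOperator_sabrLaplace f hf, laplaceBeltrami, divOperator, sqrt_det_sabrMetric hρ hp,
    partialX_eq_const_mul_of_eqOn hf.fluxX (fun q => sqrt_det_mul_inv_sabrMetric_fst hρ) hp,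
    partialY_eq_const_mul_of_eqOn hf.fluxY (fun q => sqrt_det_mul_inv_sabrMetric_snd hρ) hp,
    inv_inv, Nat.cast_zero, add_zero, mul_one]
  field_simp

end Operators

lemma exponent_bounds {β : ℝ} {j : ℕ} (hβ : -1 < β)
    (hj : (j = 0 ∧ β < 1) ∨ (j = 1 ∧ β < 1 / 2)) :
    β * (1 + j) < 1 ∧ -1 < β * (1 + j) - 2 * β ∧ -1 < 2 * β - β * (1 + j) := by
  rcases hj with ⟨rfl, h⟩ | ⟨rfl, h⟩ <;> push_cast <;> refine ⟨?_, ?_, ?_⟩ <;> linarith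

end SABR

end

open SABR in
theorem mainTheorem4_general (ρ β : ℝ) (hρ : -1 < ρ ∧ ρ < 1) (hβ : -1 < β) :
    (CompleteSpace (HilbertL2 ρ β 0) ∧ CompleteSpace (HilbertL2 ρ β 1)) ∧
    (∀ j : ℕ, ((j = 0 ∧ β < 1) ∨ (j = 1 ∧ β < 1 / 2)) →
      ((∀ f, IsTest halfPlane f → MemLp f 2 (speedMeasure ρ β j)) ∧
        (∀ f₁ f₂, IsTest halfPlane f₁ → IsTest halfPlane f₂ → ∀ u₁ u₂ : HilbertL2 ρ β j,
          u₁ =ᵐ[speedMeasure ρ β j] f₁ → u₂ =ᵐ[speedMeasure ρ β j] f₂ →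
          Integrable (gammaSmooth ρ β f₁ f₂) (speedMeasure ρ β j) ∧
          energy ρ β j u₁ u₂ = (1 / 2) * ∫ p, gammaSmooth ρ β f₁ f₂ p ∂(speedMeasure ρ β j)) ∧
        IsSymmetricForm (testDomain ρ β j) (energy ρ β j) ∧
        IsClosable (testDomain ρ β j) (energy ρ β j)) ∧
      (testDomain ρ β j ⊆ energyDomain ρ β j ∧
        IsDirichletForm (energyDomain ρ β j) (energy ρ β j))) ∧
    ((∀ f, IsTest quadrant f → ∀ p ∈ quadrant,
        sabrLaplace ρ β f p = (1 / 2) * laplaceBeltrami (sabrMetric ρ β) f p) ∧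
      FormIdentity ρ β 0 (sabrLaplace ρ β) ∧
      (β < 1 → GeneratorAgrees ρ β 0 (sabrLaplace ρ β)) ∧
      (β = 0 → FormIdentity ρ β 0 (sabrGenerator ρ β) ∧
        GeneratorAgrees ρ β 0 (sabrGenerator ρ β))) ∧
    (ρ = 0 → FormIdentity ρ β 1 (sabrGenerator ρ β) ∧
      (β < 1 / 2 → GeneratorAgrees ρ β 1 (sabrGenerator ρ β))) := by
  have hdense {j : ℕ} (hj : (j = 0 ∧ β < 1) ∨ (j = 1 ∧ β < 1 / 2)) :
      Dense (energyDomain ρ β j) :=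
    have ⟨hm, _, hx⟩ := exponent_bounds hβ hj
    dense_energyDomain hρ hm hx
  refine ⟨⟨inferInstance, inferInstance⟩, fun j hj => ?_,
    ⟨fun f hf p hp => sabrLaplace_eq_laplaceBeltrami hρ hf hp,
      isDivOperator_sabrLaplace.formIdentity hρ,
      fun hβ1 => isDivOperator_sabrLaplace.generatorAgrees hρ (hdense (.inl ⟨rfl, hβ1⟩)), ?_⟩, ?_⟩
  · obtain ⟨hm, hinv, hx⟩ := exponent_bounds hβ hj
    have hmS := locallyIntegrableOn_speedDensity_halfPlane (ρ := ρ) hm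
    have hxS := locallyIntegrableOn_speedDensity_mul_sq_halfPlane (ρ := ρ) hx
    have hsub := testDomain_subset_energyDomain hρ hm hx
    have hD := isDirichletForm_energyDomain hρ hinv (hdense hj)
    exact ⟨⟨fun f hf => hf.memLp hmS, fun f₁ f₂ hf₁ hf₂ u₁ u₂ hu₁ hu₂ =>
        ⟨hf₁.integrable_gammaSmooth hf₂ hmS hxS, hf₁.energy_eq hρ hf₂ hu₁ hu₂⟩,
      hD.toIsSymmetricForm.restrict (p := testSubmodule ρ β j) hsub (dense_testDomain hρ hm),
      hD.toIsClosedForm.isClosable_of_subset hsub⟩, hsub, hD⟩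
  · rintro rfl
    have hL := isDivOperator_sabrGenerator_of_beta_eq_zero (ρ := ρ)
    exact ⟨hL.formIdentity hρ, hL.generatorAgrees hρ (hdense (.inl ⟨rfl, zero_lt_one⟩))⟩
  · rintro rfl
    have hL := isDivOperator_sabrGenerator_of_rho_eq_zero (β := β)
    exact ⟨hL.formIdentity hρ, fun hβ2 => hL.generatorAgrees hρ (hdense (.inr ⟨rfl, hβ2⟩))⟩

theorem mainTheorem4 (ρ β : ℝ) (hρ : -1 < ρ ∧ ρ < 1) (hβ : 0 ≤ β ∧ β ≤ 1) :
    -- the weighted spaces are Hilbert spaces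
    (CompleteSpace (SABR.HilbertL2 ρ β 0) ∧ CompleteSpace (SABR.HilbertL2 ρ β 1)) ∧
    (∀ j : ℕ, ((j = 0 ∧ β < 1) ∨ (j = 1 ∧ β < 1 / 2)) →
      -- (i) the form on smooth compactly supported functions is symmetric and closable
      ((∀ f, SABR.IsTest SABR.halfPlane f → MemLp f 2 (SABR.speedMeasure ρ β j)) ∧
        (∀ f₁ f₂, SABR.IsTest SABR.halfPlane f₁ → SABR.IsTest SABR.halfPlane f₂ →
          ∀ u₁ u₂ : SABR.HilbertL2 ρ β j,
            u₁ =ᵐ[SABR.speedMeasure ρ β j] f₁ → u₂ =ᵐ[SABR.speedMeasure ρ β j] f₂ →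
            Integrable (SABR.gammaSmooth ρ β f₁ f₂) (SABR.speedMeasure ρ β j) ∧
            SABR.energy ρ β j u₁ u₂
              = (1 / 2) * ∫ p, SABR.gammaSmooth ρ β f₁ f₂ p ∂(SABR.speedMeasure ρ β j)) ∧
        SABR.IsSymmetricForm (SABR.testDomain ρ β j) (SABR.energy ρ β j) ∧
        SABR.IsClosable (SABR.testDomain ρ β j) (SABR.energy ρ β j)) ∧
      -- (ii) on the explicit domain it is a Dirichlet form extending the form in (i)
      (SABR.testDomain ρ β j ⊆ SABR.energyDomain ρ β j ∧
        SABR.IsDirichletForm (SABR.energyDomain ρ β j) (SABR.energy ρ β j))) ∧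
    -- (iii) the generator for `j = 0`
    ((∀ f, SABR.IsTest SABR.quadrant f → ∀ p ∈ SABR.quadrant,
        SABR.sabrLaplace ρ β f p
          = (1 / 2) * SABR.laplaceBeltrami (SABR.sabrMetric ρ β) f p) ∧
      SABR.FormIdentity ρ β 0 (SABR.sabrLaplace ρ β) ∧
      (β < 1 → SABR.GeneratorAgrees ρ β 0 (SABR.sabrLaplace ρ β)) ∧
      (β = 0 → SABR.FormIdentity ρ β 0 (SABR.sabrGenerator ρ β) ∧
        SABR.GeneratorAgrees ρ β 0 (SABR.sabrGenerator ρ β))) ∧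
    -- (iv) the generator for `j = 1` in the uncorrelated case
    (ρ = 0 → SABR.FormIdentity ρ β 1 (SABR.sabrGenerator ρ β) ∧
      (β < 1 / 2 → SABR.GeneratorAgrees ρ β 1 (SABR.sabrGenerator ρ β))) :=
  mainTheorem4_general ρ β hρ (by linarith [hβ.1])
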